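/- Let $d\ge 2$ and let $\Omega\subset\mathbb R^d$ be a bounded Lipschitz domain (open, connected, with boundary locally the graph of a Lipschitz function and $\Omega$ locally on one side of it), with surface measure $\sigma$ on $\partial\Omega$. Function spaces are real. Let $H^1(\Omega)$ be the Sobolev space of all $u\in L^2(\Omega)$ with weak gradient $\nabla u\in L^2(\Omega)^d$, and let the trace operator $\Gamma$ be the unique bounded linear operator from $H^1(\Omega)$ to $L^2(\partial\Omega)$ with $\Gamma u=u|_{\partial\Omega}$ for all $u\in C^1(\overline\Omega)$. Let $H^1_\partial(\Omega)$ be $H^1(\Omega)$ equipped with the inner product $$(u,v)_{\partial,\Omega}=\int_\Omega\nabla u\cdot\nabla v\,dx+\int_{\partial\Omega}\Gamma u\,\Gamma v\,d\sigma ,$$ regard $\Gamma$ as a bounded operator from $H^1_\partial(\Omega)$ to $L^2(\partial\Omega)$, and let $\Gamma^*:L^2(\partial\Omega)\to H^1_\partial(\Omega)$ be its adjoint. Let $\Lambda$ be the Moore–Penrose inverse of $\Gamma$, i.e. the unique closed densely defined linear operator from $L^2(\partial\Omega)$ to $H^1_\partial(\Omega)$ with domain $\mathcal D(\Lambda)=\mathcal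 R(\Gamma)\oplus\mathcal N(\Gamma^*)$ and null space $\mathcal N(\Lambda)=\mathcal N(\Gamma^*)$ such that $$\Gamma\Lambda\Gamma=\Gamma,\qquad \Lambda\Gamma\Lambda=\Lambda,\qquad \Gamma\Lambda\subset P_{\overline{\mathcal R(\Gamma)}},\qquad \Lambda\Gamma\subset P_{\overline{\mathcal R(\Lambda)}},$$ where $\mathcal R$ denotes the range and $P_{\mathcal E}$ the orthogonal projection on the closed subspace $\mathcal E$. Then all these operators exist and are unique, $I+\Lambda^*\Lambda$ has an everywhere defined bounded inverse on $L^2(\partial\Omega)$, and with $\mathcal H^1(\partial\Omega)=\{(I+\Lambda^*\Lambda)^{-1}g \mid g\in L^2(\partial\Omega)\}$ one has the equality of sets $$\mathcal R(\Gamma\Gamma^*)=\mathcal H^1(\partial\Omega)=\mathcal R\big((I+\Lambda^*\Lambda)^{-1}\big).$$ -/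

import Mathlib

open MeasureTheory Filter Topology
open scoped ContDiff InnerProductSpace

noncomputable section

/-! ### Bounded Lipschitz domains and their surface measure -/

/-- `ℝⁿ` with its Euclidean norm. -/
abbrev Euc (n : ℕ) : Type := EuclideanSpace ℝ (Fin n)

/-- The boundary of `Ω` is Lipschitz continuous: for every `x ∈ ∂Ω` there are an orthonormal
coordinate system `T y = (ŷ, y_n) ∈ ℝⁿ⁻¹ × ℝ`, a cylinder
`Q = {y | ‖ŷ - x̂‖ < δ, |y_n - x_n| < δ'}` and a function `γ`, Lipschitz on the ball of radius `δ`
about `x̂`, such that in `Q` the set `Ω` is `{γ(ŷ) < y_n}` and `∂Ω` is `{γ(ŷ) = y_n}`. -/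
def HasLipschitzBoundary {n : ℕ} (Ω : Set (Euc n)) : Prop :=
  ∀ x ∈ frontier Ω, ∃ (T : Euc n ≃ₗᵢ[ℝ] WithLp 2 (Euc (n - 1) × ℝ)) (δ δ' : ℝ)
    (K : NNReal) (γ : Euc (n - 1) → ℝ), 0 < δ ∧ 0 < δ' ∧
      LipschitzOnWith K γ (Metric.ball (T x).fst δ) ∧
      ∀ y : Euc n, ‖(T y).fst - (T x).fst‖ < δ → |(T y).snd - (T x).snd| < δ' →
        (y ∈ Ω ↔ γ (T y).fst < (T y).snd) ∧ (y ∈ frontier Ω ↔ γ (T y).fst = (T y).snd)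

/-- A Lipschitz domain: open, connected, with Lipschitz continuous boundary. -/
structure IsLipschitzDomain {n : ℕ} (Ω : Set (Euc n)) : Prop where
  isOpen : IsOpen Ω
  isConnected : IsConnected Ω
  lipschitz : HasLipschitzBoundary Ω

/-- The surface measure `dσ` on `∂Ω`: the `(n-1)`-dimensional Hausdorff measure, normalized so as
to agree with Lebesgue measure on `ℝⁿ⁻¹`. -/
def surfaceMeasure {n : ℕ} (Ω : Set (Euc n)) : Measure (Euc n) :=
  (Measure.euclideanHausdorffMeasure (n - 1) : Measure (Euc n)).restrict (frontier Ω)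

/-- `L²(∂Ω)`, real valued, for the surface measure. -/
abbrev L2Boundary {n : ℕ} (Ω : Set (Euc n)) : Type := Lp ℝ 2 (surfaceMeasure Ω)

/-! ### The Sobolev space `H¹(Ω)` -/

/-- The vector field `G` is the weak gradient of `u` in `Ω`: `∫_Ω u ∂ᵢφ = - ∫_Ω Gᵢ φ` for all
`φ ∈ C_c^∞(Ω)` and all `i`. -/
def IsWeakGradient {n : ℕ} (Ω : Set (Euc n)) (u : Euc n → ℝ) (G : Euc n → Euc n) : Prop :=
  ∀ φ : Euc n → ℝ, ContDiff ℝ ∞ φ → HasCompactSupport φ → tsupport φ ⊆ Ω → ∀ i : Fin n,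
    ∫ x in Ω, u x * fderiv ℝ φ x (EuclideanSpace.single i 1) = - ∫ x in Ω, G x i * φ x

/-- Products of `L²` functions with continuous compactly supported ones are integrable. -/
theorem integrable_mul_test {n : ℕ} {Ω : Set (Euc n)} {u ψ : Euc n → ℝ}
    (hu : MemLp u 2 (volume.restrict Ω)) (hψ : Continuous ψ) (hc : HasCompactSupport ψ) :
    Integrable (fun x => u x * ψ x) (volume.restrict Ω) :=
  MemLp.integrable_mul (p := 2) (q := 2) hu (hψ.memLp_of_hasCompactSupport hc)

theorem continuous_partial {n : ℕ} {φ : Euc n → ℝ} (hφ : ContDiff ℝ ∞ φ) (v : Euc n) :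
    Continuous (fun x => fderiv ℝ φ x v) :=
  (hφ.continuous_fderiv (by simp)).clm_apply continuous_const

theorem memLp_coord {n : ℕ} {μ : Measure (Euc n)} {G : Euc n → Euc n} (hG : MemLp G 2 μ)
    (i : Fin n) : MemLp (fun x => G x i) 2 μ :=
  hG.continuousLinearMap_comp (EuclideanSpace.proj (𝕜 := ℝ) i)

/-- `H¹(Ω)`: the `u ∈ L²(Ω)` whose distributional gradient is in `L²(Ω)`, each `u` being recorded
together with its gradient `∇u` (which `u` determines). The inner product inherited from
`L²(Ω) × L²(Ω; ℝⁿ)` is the usual `(u, v)_{1,Ω} = ∫_Ω u v + ∫_Ω ∇u · ∇v`. -/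
def sobolevH1 {n : ℕ} (Ω : Set (Euc n)) :
    Submodule ℝ (WithLp 2 (Lp ℝ 2 (volume.restrict Ω) × Lp (Euc n) 2 (volume.restrict Ω))) where
  carrier := {p | IsWeakGradient Ω p.fst p.snd}
  zero_mem' := by
    intro φ _ _ _ i
    have h1 : ∀ᵐ x ∂(volume.restrict Ω), (0 : Lp ℝ 2 (volume.restrict Ω)) x
        * fderiv ℝ φ x (EuclideanSpace.single i 1) = 0 := by
      filter_upwards [Lp.coeFn_zero ℝ 2 (volume.restrict Ω)] with x hx
      rw [hx, Pi.zero_apply, zero_mul]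
    have h2 : ∀ᵐ x ∂(volume.restrict Ω),
        ((0 : Lp (Euc n) 2 (volume.restrict Ω)) x) i * φ x = 0 := by
      filter_upwards [Lp.coeFn_zero (Euc n) 2 (volume.restrict Ω)] with x hx
      rw [hx, Pi.zero_apply, PiLp.zero_apply, zero_mul]
    change ∫ x in Ω, (0 : Lp ℝ 2 (volume.restrict Ω)) x
        * fderiv ℝ φ x (EuclideanSpace.single i 1)
      = - ∫ x in Ω, ((0 : Lp (Euc n) 2 (volume.restrict Ω)) x) i * φ x
    rw [integral_congr_ae h1, integral_congr_ae h2]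
    simp
  add_mem' := by
    intro p q hp hq φ hφ hc hs i
    have h1 : ∀ᵐ x ∂(volume.restrict Ω), (p + q).fst x * fderiv ℝ φ x (EuclideanSpace.single i 1)
        = p.fst x * fderiv ℝ φ x (EuclideanSpace.single i 1)
          + q.fst x * fderiv ℝ φ x (EuclideanSpace.single i 1) := by
      filter_upwards [Lp.coeFn_add p.fst q.fst] with x hx
      rw [WithLp.add_fst, hx, Pi.add_apply, add_mul]
    have h2 : ∀ᵐ x ∂(volume.restrict Ω), (p + q).snd x i * φ x
        = p.snd x i * φ x + q.snd x i * φ x := by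
      filter_upwards [Lp.coeFn_add p.snd q.snd] with x hx
      rw [WithLp.add_snd, hx, Pi.add_apply, PiLp.add_apply, add_mul]
    have hc' : HasCompactSupport (fun x => fderiv ℝ φ x (EuclideanSpace.single i 1)) :=
      hc.fderiv_apply (𝕜 := ℝ) _
    have hd := continuous_partial hφ (EuclideanSpace.single i (1 : ℝ))
    rw [integral_congr_ae h1, integral_congr_ae h2,
      integral_add (integrable_mul_test (Lp.memLp _) hd hc')
        (integrable_mul_test (Lp.memLp _) hd hc'),
      integral_add (integrable_mul_test (memLp_coord (Lp.memLp _) i) hφ.continuous hc)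
        (integrable_mul_test (memLp_coord (Lp.memLp _) i) hφ.continuous hc),
      hp φ hφ hc hs i, hq φ hφ hc hs i]
    ring
  smul_mem' := by
    intro c p hp φ hφ hc hs i
    have h1 : ∀ᵐ x ∂(volume.restrict Ω), (c • p).fst x * fderiv ℝ φ x (EuclideanSpace.single i 1)
        = c * (p.fst x * fderiv ℝ φ x (EuclideanSpace.single i 1)) := by
      filter_upwards [Lp.coeFn_smul c p.fst] with x hx
      rw [WithLp.smul_fst, hx, Pi.smul_apply, smul_eq_mul, mul_assoc]
    have h2 : ∀ᵐ x ∂(volume.restrict Ω), (c • p).snd x i * φ x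
        = c * (p.snd x i * φ x) := by
      filter_upwards [Lp.coeFn_smul c p.snd] with x hx
      rw [WithLp.smul_snd, hx, Pi.smul_apply, PiLp.smul_apply, smul_eq_mul, mul_assoc]
    rw [integral_congr_ae h1, integral_congr_ae h2, integral_const_mul, integral_const_mul,
      hp φ hφ hc hs i]
    ring

/-- `H¹(Ω)` as a type. -/
abbrev H1 {n : ℕ} (Ω : Set (Euc n)) : Type := sobolevH1 Ω

/-- The underlying `L²` function of `u ∈ H¹(Ω)`. -/
def H1.val {n : ℕ} {Ω : Set (Euc n)} (u : H1 Ω) : Lp ℝ 2 (volume.restrict Ω) := u.1.fst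

/-- The gradient `∇u ∈ L²(Ω; ℝⁿ)`, as a linear map. -/
def H1.grad {n : ℕ} (Ω : Set (Euc n)) : H1 Ω →ₗ[ℝ] Lp (Euc n) 2 (volume.restrict Ω) where
  toFun u := u.1.snd
  map_add' _ _ := rfl
  map_smul' _ _ := rfl

/-! ### The trace operator and the space `H¹_∂(Ω)` -/

/-- `Γ` is the trace operator: the bounded operator from `H¹(Ω)` to `L²(∂Ω)` that extends
restriction to the boundary, `Γ (φ|_Ω) = φ|_{∂Ω}` for `φ` continuously differentiable up to the
boundary. -/
def IsTraceOperator {n : ℕ} (Ω : Set (Euc n)) (Γ : H1 Ω →L[ℝ] L2Boundary Ω) : Prop :=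
  ∀ (u : H1 Ω) (φ : Euc n → ℝ), ContDiff ℝ 1 φ → u.val =ᵐ[volume.restrict Ω] φ →
    Γ u =ᵐ[surfaceMeasure Ω] φ

/-- `H¹_∂(Ω)`: the vector space `H¹(Ω)`, to be given the inner product
`(u, v)_{∂,Ω} = ∫_Ω ∇u · ∇v dx + ∫_{∂Ω} Γu Γv dσ`. -/
def H1Boundary {n : ℕ} {Ω : Set (Euc n)} (_Γ : H1 Ω →L[ℝ] L2Boundary Ω) : Type := H1 Ω

namespace H1Boundary

variable {n : ℕ} {Ω : Set (Euc n)} (Γ : H1 Ω →L[ℝ] L2Boundary Ω)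

instance : AddCommGroup (H1Boundary Γ) := inferInstanceAs (AddCommGroup (H1 Ω))

instance : Module ℝ (H1Boundary Γ) := inferInstanceAs (Module ℝ (H1 Ω))

/-- The identity map from `H¹_∂(Ω)` to `H¹(Ω)`. -/
def toH1 : H1Boundary Γ →ₗ[ℝ] H1 Ω := LinearMap.id (R := ℝ) (M := H1 Ω)

/-- The linear map `u ↦ (∇u, Γu)` from which the norm of `H¹_∂(Ω)` is induced. -/
def gradTrace : H1Boundary Γ →ₗ[ℝ]
    WithLp 2 (Lp (Euc n) 2 (volume.restrict Ω) × L2Boundary Ω) :=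
  (WithLp.linearEquiv 2 ℝ (Lp (Euc n) 2 (volume.restrict Ω) × L2Boundary Ω)).symm.toLinearMap ∘ₗ
    ((H1.grad Ω).prod Γ.toLinearMap) ∘ₗ toH1 Γ

instance : SeminormedAddCommGroup (H1Boundary Γ) :=
  SeminormedAddCommGroup.induced _ _ (gradTrace Γ)

instance : InnerProductSpace ℝ (H1Boundary Γ) := InnerProductSpace.induced (gradTrace Γ)

theorem inner_def (u v : H1Boundary Γ) :
    ⟪u, v⟫_ℝ = (∫ x in Ω, ⟪H1.grad Ω (toH1 Γ u) x, H1.grad Ω (toH1 Γ v) x⟫_ℝ)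
      + ∫ x, Γ (toH1 Γ u) x * Γ (toH1 Γ v) x ∂(surfaceMeasure Ω) := by
  have h : ⟪u, v⟫_ℝ = ⟪gradTrace Γ u, gradTrace Γ v⟫_ℝ := rfl
  rw [h, WithLp.prod_inner_apply, L2.inner_def, L2.inner_def]
  congr 1
  refine integral_congr_ae (Eventually.of_forall fun x => ?_)
  exact mul_comm _ _

/-- The trace operator as an operator from `H¹_∂(Ω)` to `L²(∂Ω)`. -/
def trace : H1Boundary Γ →L[ℝ] L2Boundary Ω :=
  LinearMap.mkContinuous (Γ.toLinearMap ∘ₗ toH1 Γ) 1 (by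
    intro u
    have h : ‖u‖ = ‖gradTrace Γ u‖ := rfl
    rw [one_mul, h]
    exact WithLp.norm_snd_le (p := 2) _ (gradTrace Γ u))

end H1Boundary

/-! ### Moore–Penrose inverses, adjoints and `(I + B*B)⁻¹` -/

section Operators

variable {E F : Type*} [SeminormedAddCommGroup E] [InnerProductSpace ℝ E]
  [NormedAddCommGroup F] [InnerProductSpace ℝ F]

/-- `p = P_M x`, the orthogonal projection of `x` on the closed subspace `M`. -/
def IsOrthProj {V : Type*} [SeminormedAddCommGroup V] [InnerProductSpace ℝ V]
    (M : Submodule ℝ V) (x p : V) : Prop :=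
  p ∈ M ∧ ∀ w ∈ M, ⟪w, x - p⟫_ℝ = 0

/-- `As` is the adjoint `A*` of the bounded operator `A`. -/
def IsAdjointOf (A : E →L[ℝ] F) (As : F →L[ℝ] E) : Prop :=
  ∀ (g : F) (u : E), ⟪As g, u⟫_ℝ = ⟪g, A u⟫_ℝ

/-- `B` is the Moore–Penrose inverse of the bounded operator `A`: it is closed, densely defined,
`D(B) = R(A) ⊕ N(A*)`, `N(B) = N(A*)`, `ABA = A`, `BAB = B`, `AB ⊂ P` on the closure of `R(A)` and
`BA ⊂ P` on the closure of `R(B)`. Here `N(A*)` is written as `R(A)ᗮ`. -/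
structure IsMoorePenroseInverse (A : E →L[ℝ] F) (B : F →ₗ.[ℝ] E) : Prop where
  isClosed : B.IsClosed
  dense : Dense (B.domain : Set F)
  domain_eq : B.domain = A.range ⊔ (A.range)ᗮ
  ker_eq : ∀ y : B.domain, B y = 0 ↔ (y : F) ∈ (A.range)ᗮ
  mul_mul_left : ∀ (x : E) (y : B.domain), (y : F) = A x → A (B y) = A x
  mul_mul_right : ∀ y z : B.domain, (z : F) = A (B y) → B z = B y
  proj_left : ∀ y : B.domain, IsOrthProj A.range.topologicalClosure (y : F) (A (B y))
  proj_right : ∀ (x : E) (y : B.domain), (y : F) = A x →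
    IsOrthProj (LinearMap.range B.toFun).topologicalClosure x (B y)

/-- For a densely defined operator `B`: `x ∈ D(B*)` and `B* x = f`. -/
def AdjointRel (B : F →ₗ.[ℝ] E) (x : E) (f : F) : Prop :=
  ∀ y : B.domain, ⟪B y, x⟫_ℝ = ⟪(y : F), f⟫_ℝ

/-- For a densely defined operator `B`: `h ∈ D(B*B)` and `(I + B*B) h = g`. -/
def OneAddAdjCompRel (B : F →ₗ.[ℝ] E) (h g : F) : Prop :=
  ∃ y : B.domain, (y : F) = h ∧ ∃ f : F, AdjointRel B (B y) f ∧ h + f = g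

/-- The bounded everywhere defined operator `R` is `(I + B*B)⁻¹`. -/
def IsInvOneAddAdjComp (B : F →ₗ.[ℝ] E) (R : F →L[ℝ] F) : Prop :=
  ∀ g h : F, R g = h ↔ OneAddAdjCompRel B h g

end Operators

end

/-!
The functional analysis is short once `H¹_∂(Ω)` is known to be a Hilbert space on which the trace
`Γ` has dense range. Then `N(Γ*) = R(Γ)ᗮ = 0`, the Moore–Penrose inverse `Λ` is the inverse of the
restriction of `Γ` to `N(Γ)ᗮ`, and unwinding the definition of `Λ*Λ` gives
`(I + Λ*Λ)⁻¹ = ΓΓ* (I + ΓΓ*)⁻¹`, where `I + ΓΓ*` is coercive and hence bijective. So the two ranges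
agree (`exists_isInvOneAddAdjComp`).

The analysis on the Lipschitz domain consists of three facts.

* `denseRange_ofC1`: the `C¹` functions are dense in `H¹(Ω)`. If `v ∈ H¹(Ω)` is orthogonal to all of
  them and `χ` is a cut-off supported near a point of `closure Ω`, then `χ v` can be mollified with
  kernels shifted into the interior cone at that point, so that only values of `v` inside `Ω` enter.
  The pairing of `v` with these mollifications is the mollification of a continuous correlation;
  passing to the limit, `v` is orthogonal to `χ v`, and a partition of unity gives `v = 0`.
* `exists_trace_inequality`: the `L²(∂Ω)` norm of a `C¹` function is bounded by its `H¹(Ω)` norm. In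
  a chart, surface measure is comparable with Lebesgue measure of the base, since the graph map and
  the projection are Lipschitz, and the estimate follows by integrating `∂(χ φ²)` vertically.
  With density, this gives existence and uniqueness of `Γ`.
* `exists_friedrichs_inequality`: the `L²(Ω)` norm is bounded by the norms of the gradient and of
  the trace. It follows from `exists_integral_fderiv_le`, a substitute for the divergence theorem.
  Hence the norms of `H¹_∂(Ω)` and `H¹(Ω)` are equivalent, and `H¹_∂(Ω)` is complete and separated.

The range of `Γ` is dense since smooth functions are dense in `L²` of a finite measure on `ℝⁿ`.
-/

noncomputable section

/-! ### Moore–Penrose inverses of operators with dense range -/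

section OperatorTheory

variable {E F : Type*} [NormedAddCommGroup E] [InnerProductSpace ℝ E]
  [NormedAddCommGroup F] [InnerProductSpace ℝ F]

theorem existsUnique_isAdjointOf [CompleteSpace E] [CompleteSpace F] (A : E →L[ℝ] F) :
    ∃! As : F →L[ℝ] E, IsAdjointOf A As := by
  refine ⟨ContinuousLinearMap.adjoint A, fun g u => ContinuousLinearMap.adjoint_inner_left A u g,
    fun B hB => ?_⟩
  ext g
  refine ext_inner_right ℝ fun u => ?_
  rw [hB g u, ContinuousLinearMap.adjoint_inner_left]

namespace IsMoorePenroseInverse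

variable {A : E →L[ℝ] F} {B : F →ₗ.[ℝ] E}

/-- The values of the Moore–Penrose inverse are orthogonal to the null space of `A`. -/
theorem apply_mem_ker_orthogonal (hB : IsMoorePenroseInverse A B) (y : B.domain) :
    B y ∈ (LinearMap.ker A.toLinearMap)ᗮ := by
  intro k hk
  have h := hB.proj_right k 0 (by simpa using (LinearMap.mem_ker.1 hk).symm)
  have h2 := h.2 (B y) (Submodule.le_topologicalClosure _ ⟨y, rfl⟩)
  rw [LinearPMap.map_zero, sub_zero] at h2
  rw [real_inner_comm]
  exact h2

theorem map_mem_domain (hB : IsMoorePenroseInverse A B) (x : E) : A x ∈ B.domain := by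
  rw [hB.domain_eq]
  exact Submodule.mem_sup_left ⟨x, rfl⟩

end IsMoorePenroseInverse

theorem eq_of_map_eq_of_mem_ker_orthogonal {A : E →L[ℝ] F} {v w : E} (h : A v = A w)
    (hv : v ∈ (LinearMap.ker A.toLinearMap)ᗮ) (hw : w ∈ (LinearMap.ker A.toLinearMap)ᗮ) :
    v = w := by
  have h1 : v - w ∈ LinearMap.ker A.toLinearMap := by
    simp [h]
  have h2 := (Submodule.sub_mem _ hv hw) (v - w) h1
  rw [inner_self_eq_zero] at h2
  exact sub_eq_zero.1 h2

variable {A : E →L[ℝ] F}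

theorem orthogonal_range_eq_bot (hA : DenseRange A) : (A.range)ᗮ = ⊥ := by
  rw [Submodule.eq_bot_iff]
  intro y hy
  have h : ∀ z : F, ⟪y, z⟫_ℝ = 0 := by
    intro z
    refine hA.induction_on (p := fun z => ⟪y, z⟫_ℝ = 0) z
      (isClosed_eq (by fun_prop) continuous_const) fun x => ?_
    rw [real_inner_comm]
    exact hy (A x) ⟨x, rfl⟩
  exact inner_self_eq_zero.1 (h y)

theorem IsMoorePenroseInverse.domain_eq_range {B : F →ₗ.[ℝ] E} (hB : IsMoorePenroseInverse A B)
    (hA : DenseRange A) : B.domain = A.range := by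
  rw [hB.domain_eq, orthogonal_range_eq_bot hA, sup_bot_eq]

/-- If `A` has dense range, its Moore–Penrose inverse is a right inverse. -/
theorem IsMoorePenroseInverse.apply_apply {B : F →ₗ.[ℝ] E} (hB : IsMoorePenroseInverse A B)
    (hA : DenseRange A) (y : B.domain) : A (B y) = y := by
  have hy : (y : F) ∈ A.range := hB.domain_eq_range hA ▸ y.2
  obtain ⟨x, hx⟩ := hy
  rw [hB.mul_mul_left x y hx.symm]
  exact hx

/-- With dense range, the Moore–Penrose inverse of `A` is the inverse of the restriction of `A` to
`N(A)ᗮ`. It is closed because its graph is `{(A v, v) | v ∈ N(A)ᗮ}`. -/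
theorem existsUnique_isMoorePenroseInverse [CompleteSpace E] (hA : DenseRange A) :
    ∃! B : F →ₗ.[ℝ] E, IsMoorePenroseInverse A B := by
  set K := LinearMap.ker A.toLinearMap with hK
  have hKc : IsClosed (K : Set E) := A.isClosed_ker
  have : CompleteSpace K := hKc.completeSpace_coe
  have hdec : ∀ x : E, ∃ w ∈ Kᗮ, A w = A x ∧ x - w ∈ K := by
    intro x
    have h1 : x - Kᗮ.starProjection x ∈ Kᗮᗮ := Submodule.sub_starProjection_mem_orthogonal x
    rw [Submodule.orthogonal_orthogonal] at h1
    refine ⟨Kᗮ.starProjection x, Submodule.starProjection_apply_mem _ _, ?_, h1⟩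
    have h2 : A (x - Kᗮ.starProjection x) = 0 := h1
    rw [map_sub, sub_eq_zero] at h2
    exact h2.symm
  let f : Kᗮ →ₗ[ℝ] A.range := A.toLinearMap.rangeRestrict ∘ₗ Kᗮ.subtype
  have hf : ∀ w : Kᗮ, ((f w : A.range) : F) = A w := fun _ => rfl
  have hbij : Function.Bijective f := by
    constructor
    · intro v w h
      have h' : A v = A w := by rw [← hf, h, hf]
      exact Subtype.ext (eq_of_map_eq_of_mem_ker_orthogonal h' v.2 w.2)
    · rintro ⟨_, x, rfl⟩
      obtain ⟨w, hw, hwx, _⟩ := hdec x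
      exact ⟨⟨w, hw⟩, Subtype.ext hwx⟩
  let e : Kᗮ ≃ₗ[ℝ] A.range := LinearEquiv.ofBijective f hbij
  let B : F →ₗ.[ℝ] E := ⟨A.range, Kᗮ.subtype ∘ₗ e.symm.toLinearMap⟩
  have hBmem : ∀ y : B.domain, B y ∈ Kᗮ := fun y => (e.symm y).2
  have hAB : ∀ y : B.domain, A (B y) = y := fun y => by
    have := congrArg Subtype.val (e.apply_symm_apply y)
    exact this
  have hBA : ∀ (y : B.domain) (w : E), w ∈ Kᗮ → A w = y → B y = w := fun y w hw h =>
    eq_of_map_eq_of_mem_ker_orthogonal ((hAB y).trans h.symm) (hBmem y) hw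
  have hbot := orthogonal_range_eq_bot hA
  have hMP : IsMoorePenroseInverse A B := by
    refine ⟨?_, ?_, ?_, ?_, ?_, ?_, ?_, ?_⟩
    · have hg : (B.graph : Set (F × E)) = {p | p.2 ∈ Kᗮ ∧ A p.2 = p.1} := by
        ext ⟨y, v⟩
        simp only [SetLike.mem_coe, LinearPMap.mem_graph_iff, Set.mem_ofPred_eq]
        constructor
        · rintro ⟨z, rfl, rfl⟩
          exact ⟨hBmem z, hAB z⟩
        · rintro ⟨hv, rfl⟩
          exact ⟨⟨A v, v, rfl⟩, rfl, hBA _ v hv rfl⟩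
      change IsClosed (B.graph : Set (F × E))
      rw [hg]
      exact (K.isClosed_orthogonal.preimage continuous_snd).inter
        (isClosed_eq (by fun_prop) continuous_fst)
    · exact hA
    · rw [hbot, sup_bot_eq]
    · intro y
      rw [hbot, Submodule.mem_bot]
      constructor
      · intro h
        rw [← hAB y, h, map_zero]
      · intro h
        exact hBA y 0 (Submodule.zero_mem _) (by rw [map_zero, h])
    · intro x y h
      rw [hAB, h]
    · intro y z h
      exact hBA z _ (hBmem y) h.symm
    · intro y
      refine ⟨Submodule.le_topologicalClosure _ ⟨B y, rfl⟩, fun w _ => ?_⟩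
      rw [hAB, sub_self, inner_zero_right]
    · intro x y h
      refine ⟨Submodule.le_topologicalClosure _ ⟨y, rfl⟩, fun w hw => ?_⟩
      have hwK : w ∈ Kᗮ := by
        refine Submodule.topologicalClosure_minimal _ ?_ K.isClosed_orthogonal hw
        rintro _ ⟨z, rfl⟩
        exact hBmem z
      rw [real_inner_comm]
      refine hwK _ ?_
      change A (x - B y) = 0
      rw [map_sub, hAB, h, sub_self]
  refine ⟨B, hMP, fun C hC => ?_⟩
  have hdom : C.domain = B.domain := hC.domain_eq_range hA
  refine LinearPMap.ext hdom fun y hy hy' => ?_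
  exact eq_of_map_eq_of_mem_ker_orthogonal ((hC.apply_apply hA ⟨y, hy⟩).trans (hAB ⟨y, hy'⟩).symm)
    (hC.apply_mem_ker_orthogonal _) (hBmem _)

/-- If `A` has dense range, then `I + A A*` is invertible and
`(I + B*B)⁻¹ = A A* (I + A A*)⁻¹` for the Moore–Penrose inverse `B` of `A`. -/
theorem exists_isInvOneAddAdjComp [CompleteSpace F] (hA : DenseRange A)
    {As : F →L[ℝ] E} {B : F →ₗ.[ℝ] E} (hAs : IsAdjointOf A As)
    (hB : IsMoorePenroseInverse A B) :
    ∃ R : F →L[ℝ] F, IsInvOneAddAdjComp B R ∧ Set.range (A ∘L As) = Set.range R := by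
  let T : F →L[ℝ] F := A ∘L As
  have hT : ∀ g h, ⟪T g, h⟫_ℝ = ⟪As h, As g⟫_ℝ := fun g h => by
    rw [hAs h (As g), real_inner_comm]; rfl
  -- `I + A A*` is coercive, hence invertible by Lax–Milgram.
  let b : F →L[ℝ] F →L[ℝ] ℝ := innerSL ℝ ∘L (ContinuousLinearMap.id ℝ F + T)
  have hb : ∀ g h, b g h = ⟪g, h⟫_ℝ + ⟪T g, h⟫_ℝ := fun g h => by
    simp only [b, ContinuousLinearMap.comp_apply, add_apply,
      ContinuousLinearMap.id_apply, map_add]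
    rfl
  have hco : IsCoercive b := by
    refine ⟨1, one_pos, fun g => ?_⟩
    rw [hb, hT, real_inner_self_eq_norm_mul_norm, one_mul]
    have := real_inner_self_nonneg (x := As g)
    linarith
  let S : F ≃L[ℝ] F := hco.continuousLinearEquivOfBilin
  have hS : ∀ g, S g = g + T g := fun g => by
    refine ext_inner_right ℝ fun h => ?_
    rw [hco.continuousLinearEquivOfBilin_apply, hb, inner_add_left]
  refine ⟨T ∘L (S.symm : F →L[ℝ] F), fun g h => ?_, ?_⟩
  · have hmem : ∀ k, As k ∈ (LinearMap.ker A.toLinearMap)ᗮ := fun k w hw => by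
      have h0 : A w = 0 := hw
      rw [real_inner_comm, hAs, h0, inner_zero_right]
    constructor
    · rintro rfl
      set k := S.symm g with hk
      have hgk : k + T k = g := by rw [← hS, hk, S.apply_symm_apply]
      let y : B.domain := ⟨A (As k), hB.map_mem_domain _⟩
      have hBy : B y = As k := eq_of_map_eq_of_mem_ker_orthogonal (hB.apply_apply hA y)
        (hB.apply_mem_ker_orthogonal y) (hmem k)
      refine ⟨y, rfl, k, fun z => ?_, ?_⟩
      · rw [hBy, real_inner_comm, hAs, hB.apply_apply hA, real_inner_comm]
      · change T k + k = g
        rw [add_comm, hgk]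
    · rintro ⟨y, rfl, f, hf, hg⟩
      have h1 : B y = As f := by
        refine ext_inner_left ℝ fun x => ?_
        let z : B.domain := ⟨A x, hB.map_mem_domain x⟩
        have h2 : ⟪x - B z, B y⟫_ℝ = 0 := by
          refine hB.apply_mem_ker_orthogonal y _ ?_
          change A (x - B z) = 0
          rw [map_sub, hB.apply_apply hA, sub_self]
        rw [inner_sub_left, sub_eq_zero] at h2
        rw [h2, hf z, real_inner_comm, ← hAs, real_inner_comm]
      have h3 : (y : F) = T f := by
        rw [← hB.apply_apply hA y, h1]; rfl
      have h4 : S f = g := by rw [hS, ← h3, add_comm, hg]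
      change T (S.symm g) = y
      rw [← h4, S.symm_apply_apply, h3]
  · ext h
    constructor
    · rintro ⟨k, rfl⟩
      exact ⟨S k, by simp [T]⟩
    · rintro ⟨k, rfl⟩
      exact ⟨S.symm k, rfl⟩

end OperatorTheory

/-! ### The Hilbert space `H¹(Ω)` and the embedding of `C¹` functions -/

section SobolevBasics

variable {n : ℕ} {Ω : Set (Euc n)}

theorem continuous_integral_inner {F : Type*} [NormedAddCommGroup F] [InnerProductSpace ℝ F]
    {μ : Measure (Euc n)} {g : Euc n → F} (hg : MemLp g 2 μ) :
    Continuous fun f : Lp F 2 μ => ∫ x, ⟪g x, f x⟫_ℝ ∂μ := by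
  have h : (fun f : Lp F 2 μ => ∫ x, ⟪g x, f x⟫_ℝ ∂μ) = fun f => ⟪hg.toLp g, f⟫_ℝ := by
    ext f
    rw [L2.inner_def]
    refine integral_congr_ae ?_
    filter_upwards [hg.coeFn_toLp] with x hx
    rw [hx]
  rw [h]
  fun_prop

/-- Each integration by parts identity defining `H¹(Ω)` is an equation between continuous
functionals on `L²`. -/
theorem isClosed_sobolevH1 :
    IsClosed (sobolevH1 Ω : Set (WithLp 2
      (Lp ℝ 2 (volume.restrict Ω) × Lp (Euc n) 2 (volume.restrict Ω)))) := by
  have h : (sobolevH1 Ω : Set (WithLp 2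
      (Lp ℝ 2 (volume.restrict Ω) × Lp (Euc n) 2 (volume.restrict Ω)))) =
      {p | IsWeakGradient Ω p.fst p.snd} := rfl
  rw [h]
  simp only [IsWeakGradient, Set.ofPred_forall]
  refine isClosed_iInter fun φ => isClosed_iInter fun hφ => isClosed_iInter fun hc =>
    isClosed_iInter fun _ => isClosed_iInter fun i => ?_
  have hd : MemLp (fun x => fderiv ℝ φ x (EuclideanSpace.single i 1)) 2 (volume.restrict Ω) :=
    (continuous_partial hφ _).memLp_of_hasCompactSupport (hc.fderiv_apply (𝕜 := ℝ) _)
  have hs : MemLp (fun x => φ x • EuclideanSpace.single i (1 : ℝ)) 2 (volume.restrict Ω) :=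
    Continuous.memLp_of_hasCompactSupport (by have := hφ.continuous; fun_prop) hc.smul_right
  have h1 := (continuous_integral_inner hd).comp (WithLp.continuous_fst 2
    (Lp ℝ 2 (volume.restrict Ω)) (Lp (Euc n) 2 (volume.restrict Ω)))
  have h2 := (continuous_integral_inner hs).comp (WithLp.continuous_snd 2
    (Lp ℝ 2 (volume.restrict Ω)) (Lp (Euc n) 2 (volume.restrict Ω)))
  convert isClosed_eq h1 h2.neg using 5 with p
  · simp
  · simp [inner_smul_left, EuclideanSpace.inner_single_left, mul_comm]

instance : CompleteSpace (H1 Ω) := isClosed_sobolevH1.completeSpace_coe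

/-- The gradient of an `H¹` function is determined by the function. -/
theorem H1.ext_val (hΩ : IsOpen Ω) {u v : H1 Ω} (h : u.val = v.val) : u = v := by
  have hfst : u.1.fst = v.1.fst := h
  have hsnd : u.1.snd = v.1.snd := by
    have key : ∀ i : Fin n, ∀ᵐ x ∂volume, x ∈ Ω → u.1.snd x i - v.1.snd x i = 0 := by
      intro i
      have hI : ∀ w : H1 Ω, LocallyIntegrableOn (fun x => w.1.snd x i) Ω := fun w =>
        locallyIntegrableOn_of_locallyIntegrable_restrict
          (MemLp.locallyIntegrable (p := 2) (memLp_coord (Lp.memLp w.1.snd) i) (by norm_num))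
      refine hΩ.ae_eq_zero_of_integral_contDiff_smul_eq_zero ((hI u).sub (hI v)) ?_
      intro φ hφ hc hs
      have hu := u.2 φ hφ hc hs i
      have hv := v.2 φ hφ hc hs i
      have hi : ∀ w : H1 Ω, Integrable (fun x => w.1.snd x i * φ x) (volume.restrict Ω) :=
        fun w => integrable_mul_test (memLp_coord (Lp.memLp _) i) hφ.continuous hc
      rw [← setIntegral_eq_integral_of_forall_compl_eq_zero (s := Ω)]
      · have h3 : ∫ x in Ω, u.1.snd x i * φ x = ∫ x in Ω, v.1.snd x i * φ x := by
          rw [hfst, hv] at hu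
          exact (neg_injective hu).symm
        rw [← sub_eq_zero, ← integral_sub (hi u) (hi v)] at h3
        rw [← h3]
        refine integral_congr_ae (Eventually.of_forall fun x => ?_)
        simp only [smul_eq_mul]
        ring
      · intro x hx
        have : φ x = 0 := by
          by_contra h0
          exact hx (hs (subset_tsupport φ h0))
        simp [this]
    refine Lp.ext ?_
    have hall := ae_all_iff.2 key
    rw [EventuallyEq, ae_restrict_iff' hΩ.measurableSet]
    filter_upwards [hall] with x hx hxΩ
    ext i
    exact sub_eq_zero.1 (hx i hxΩ)
  apply Subtype.ext
  apply (WithLp.equiv 2 _).injective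
  exact Prod.ext hfst hsnd

theorem Continuous.memLp_restrict_of_isBounded {F : Type*} [NormedAddCommGroup F]
    {p : ENNReal} (hb : Bornology.IsBounded Ω) {f : Euc n → F} (hf : Continuous f) :
    MemLp f p (volume.restrict Ω) := by
  have hK : IsCompact (closure Ω) := hb.isCompact_closure
  obtain ⟨C, hC⟩ := hK.exists_bound_of_continuousOn hf.continuousOn
  have : IsFiniteMeasure ((volume : Measure (Euc n)).restrict (closure Ω)) :=
    ⟨by simpa using hK.measure_lt_top⟩
  have h1 : MemLp f p (volume.restrict (closure Ω)) :=
    MemLp.of_bound hf.aestronglyMeasurable C (by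
      filter_upwards [ae_restrict_mem hK.measurableSet] with x hx using hC x hx)
  exact h1.mono_measure (Measure.restrict_mono subset_closure le_rfl)

theorem continuous_gradient {φ : Euc n → ℝ} (hφ : ContDiff ℝ 1 φ) : Continuous (gradient φ) :=
  (InnerProductSpace.toDual ℝ (Euc n)).symm.continuous.comp (hφ.continuous_fderiv one_ne_zero)

theorem gradient_apply {φ : Euc n → ℝ} (x : Euc n) (i : Fin n) :
    gradient φ x i = fderiv ℝ φ x (EuclideanSpace.single i 1) := by
  have h := InnerProductSpace.toDual_symm_apply (𝕜 := ℝ) (x := EuclideanSpace.single i (1 : ℝ))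
    (y := fderiv ℝ φ x)
  rw [← h, EuclideanSpace.inner_single_right]
  simp [gradient]

/-- The functions of class `C¹` on `ℝⁿ`. -/
def contDiffOne (n : ℕ) : Submodule ℝ (Euc n → ℝ) where
  carrier := {φ | ContDiff ℝ 1 φ}
  add_mem' {φ ψ} ha hb := by
    have ha' : ContDiff ℝ 1 φ := ha
    have hb' : ContDiff ℝ 1 ψ := hb
    exact ha'.add hb'
  zero_mem' := by
    have h : ContDiff ℝ 1 (0 : Euc n → ℝ) := contDiff_const
    exact h
  smul_mem' c φ h := by
    have h' : ContDiff ℝ 1 φ := h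
    exact h'.const_smul c

theorem contDiffOne.contDiff (φ : contDiffOne n) : ContDiff ℝ 1 φ.1 := φ.2

theorem isWeakGradient_gradient {φ : Euc n → ℝ} (hφ : ContDiff ℝ 1 φ) :
    IsWeakGradient Ω φ (gradient φ) := by
  intro ψ hψ hc hs i
  have hz : ∀ x, x ∉ Ω → ψ x = 0 := fun x hx => by
    by_contra h0
    exact hx (hs (subset_tsupport ψ h0))
  have hz' : ∀ x, x ∉ Ω → fderiv ℝ ψ x = 0 := fun x hx => by
    by_contra h0
    exact hx (hs (tsupport_fderiv_subset ℝ (subset_tsupport _ h0)))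
  rw [setIntegral_eq_integral_of_forall_compl_eq_zero (fun x hx => by simp [hz' x hx]),
    setIntegral_eq_integral_of_forall_compl_eq_zero (fun x hx => by simp [hz x hx])]
  simp only [gradient_apply]
  have hcφ := hφ.continuous
  have hcψ := hψ.continuous
  have h1 := continuous_partial hψ (EuclideanSpace.single i 1)
  have h2 : Continuous fun x => fderiv ℝ φ x (EuclideanSpace.single i 1) :=
    (hφ.continuous_fderiv one_ne_zero).clm_apply continuous_const
  refine integral_mul_fderiv_eq_neg_fderiv_mul_of_integrable
    ((h2.mul hcψ).integrable_of_hasCompactSupport hc.mul_left)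
    ((hcφ.mul h1).integrable_of_hasCompactSupport (hc.fderiv_apply (𝕜 := ℝ) _).mul_left)
    ((hcφ.mul hcψ).integrable_of_hasCompactSupport hc.mul_left)
    (fun x _ => hφ.differentiable one_ne_zero x)
    (fun x _ => hψ.differentiable (by simp) x)

theorem memLp_of_contDiffOne (hb : Bornology.IsBounded Ω) (φ : contDiffOne n) :
    MemLp φ.1 2 (volume.restrict Ω) :=
  Continuous.memLp_restrict_of_isBounded hb (contDiffOne.contDiff φ).continuous

theorem memLp_gradient_of_contDiffOne (hb : Bornology.IsBounded Ω) (φ : contDiffOne n) :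
    MemLp (gradient φ.1) 2 (volume.restrict Ω) :=
  Continuous.memLp_restrict_of_isBounded hb (continuous_gradient (contDiffOne.contDiff φ))

theorem gradient_add_contDiffOne (φ ψ : contDiffOne n) :
    gradient (φ + ψ).1 = gradient φ.1 + gradient ψ.1 := by
  ext1 x
  change (InnerProductSpace.toDual ℝ (Euc n)).symm (fderiv ℝ (φ.1 + ψ.1) x) =
    (InnerProductSpace.toDual ℝ (Euc n)).symm (fderiv ℝ φ.1 x) +
      (InnerProductSpace.toDual ℝ (Euc n)).symm (fderiv ℝ ψ.1 x)
  rw [fderiv_add ((contDiffOne.contDiff φ).differentiable one_ne_zero x)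
    ((contDiffOne.contDiff ψ).differentiable one_ne_zero x), map_add]

theorem gradient_smul_contDiffOne (c : ℝ) (φ : contDiffOne n) :
    gradient (c • φ).1 = c • gradient φ.1 := by
  ext1 x
  change (InnerProductSpace.toDual ℝ (Euc n)).symm (fderiv ℝ (c • φ.1) x) =
    c • (InnerProductSpace.toDual ℝ (Euc n)).symm (fderiv ℝ φ.1 x)
  rw [fderiv_const_smul ((contDiffOne.contDiff φ).differentiable one_ne_zero x), map_smul]

/-- The pair `(φ, ∇φ)` of `L²` functions on a bounded set. -/
def contDiffOne.toLpProd (hb : Bornology.IsBounded Ω) :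
    contDiffOne n →ₗ[ℝ] Lp ℝ 2 (volume.restrict Ω) × Lp (Euc n) 2 (volume.restrict Ω) where
  toFun φ := ((memLp_of_contDiffOne hb φ).toLp φ.1,
    (memLp_gradient_of_contDiffOne hb φ).toLp (gradient φ.1))
  map_add' φ ψ := by
    refine Prod.ext rfl ?_
    refine (MemLp.toLp_congr (memLp_gradient_of_contDiffOne hb (φ + ψ))
      ((memLp_gradient_of_contDiffOne hb φ).add (memLp_gradient_of_contDiffOne hb ψ))
      (Eventually.of_forall fun x => ?_))
    rw [gradient_add_contDiffOne]
  map_smul' c φ := by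
    refine Prod.ext rfl ?_
    refine (MemLp.toLp_congr (memLp_gradient_of_contDiffOne hb (c • φ))
      ((memLp_gradient_of_contDiffOne hb φ).const_smul c)
      (Eventually.of_forall fun x => ?_))
    rw [gradient_smul_contDiffOne]

/-- The restriction to a bounded `Ω` of a function of class `C¹`, as an element of `H¹(Ω)`. -/
def H1.ofC1 (hb : Bornology.IsBounded Ω) : contDiffOne n →ₗ[ℝ] H1 Ω :=
  LinearMap.codRestrict (sobolevH1 Ω)
    ((WithLp.linearEquiv 2 ℝ (Lp ℝ 2 (volume.restrict Ω) ×
      Lp (Euc n) 2 (volume.restrict Ω))).symm.toLinearMap ∘ₗ contDiffOne.toLpProd hb) <| by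
    intro φ ψ hψ hc hs i
    have h := isWeakGradient_gradient (Ω := Ω) (contDiffOne.contDiff φ) ψ hψ hc hs i
    refine Eq.trans ?_ (h.trans ?_)
    · refine integral_congr_ae ?_
      filter_upwards [(memLp_of_contDiffOne hb φ).coeFn_toLp] with x hx
      exact congrArg (fun v : ℝ => v * fderiv ℝ ψ x (EuclideanSpace.single i 1)) hx
    · refine congrArg Neg.neg (integral_congr_ae ?_)
      filter_upwards [(memLp_gradient_of_contDiffOne hb φ).coeFn_toLp] with x hx
      exact congrArg (fun v : Euc n => v i * ψ x) hx.symm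

theorem H1.ofC1_val (hb : Bornology.IsBounded Ω) (φ : contDiffOne n) :
    (H1.ofC1 hb φ).val =ᵐ[volume.restrict Ω] φ.1 :=
  (memLp_of_contDiffOne hb φ).coeFn_toLp

theorem H1.ofC1_grad (hb : Bornology.IsBounded Ω) (φ : contDiffOne n) :
    H1.grad Ω (H1.ofC1 hb φ) =ᵐ[volume.restrict Ω] gradient φ.1 :=
  (memLp_gradient_of_contDiffOne hb φ).coeFn_toLp

theorem H1.eq_ofC1 (hΩ : IsOpen Ω) (hb : Bornology.IsBounded Ω) {u : H1 Ω} {φ : Euc n → ℝ}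
    (hφ : ContDiff ℝ 1 φ) (h : u.val =ᵐ[volume.restrict Ω] φ) : u = H1.ofC1 hb ⟨φ, hφ⟩ :=
  H1.ext_val hΩ (Lp.ext (h.trans (H1.ofC1_val hb ⟨φ, hφ⟩).symm))

theorem H1.norm_sq_ofC1 (hb : Bornology.IsBounded Ω) (φ : contDiffOne n) :
    ‖H1.ofC1 hb φ‖ ^ 2 = (∫ x in Ω, φ.1 x ^ 2) + ∫ x in Ω, ‖gradient φ.1 x‖ ^ 2 := by
  have h : ‖H1.ofC1 hb φ‖ ^ 2 = ‖(H1.ofC1 hb φ).val‖ ^ 2 + ‖H1.grad Ω (H1.ofC1 hb φ)‖ ^ 2 :=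
    WithLp.prod_norm_sq_eq_of_L2 _
  rw [h, ← real_inner_self_eq_norm_sq, ← real_inner_self_eq_norm_sq, L2.inner_def, L2.inner_def]
  congr 1
  · refine integral_congr_ae ?_
    filter_upwards [H1.ofC1_val hb φ] with x hx
    rw [hx, real_inner_self_eq_norm_sq, Real.norm_eq_abs, sq_abs]
  · refine integral_congr_ae ?_
    filter_upwards [H1.ofC1_grad hb φ] with x hx
    rw [hx, real_inner_self_eq_norm_sq]

end SobolevBasics

/-! ### Lipschitz boundary charts and surface measure -/

section Charts

variable {n : ℕ}

/-- A rigid change of coordinates `ℝⁿ ≅ ℝⁿ⁻¹ × ℝ`. -/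
abbrev GraphCoord (n : ℕ) : Type := Euc n ≃ₗᵢ[ℝ] WithLp 2 (Euc (n - 1) × ℝ)

namespace GraphCoord

variable (T : GraphCoord n) (g : Euc (n - 1) → ℝ)

/-- The unit vector along the last axis of the coordinate system `T`. -/
def vert : Euc n := T.symm (WithLp.toLp 2 (0, 1))

/-- The point of the graph of `g` above `a`. -/
def graphPt (a : Euc (n - 1)) : Euc n := T.symm (WithLp.toLp 2 (a, g a))

/-- Coordinates adapted to the graph of `g`: the base point and the height above the graph. -/
def shear (z : Euc (n - 1) × ℝ) : Euc n := T.symm (WithLp.toLp 2 (z.1, g z.1 + z.2))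

theorem shear_eq (z : Euc (n - 1) × ℝ) : T.shear g z = T.graphPt g z.1 + z.2 • T.vert := by
  apply T.injective
  simp only [shear, graphPt, vert, map_add, map_smul, LinearIsometryEquiv.apply_symm_apply]
  apply (WithLp.equiv 2 _).injective
  simp

theorem norm_vert : ‖T.vert‖ = 1 := by
  rw [vert, LinearIsometryEquiv.norm_map, WithLp.norm_toLp_snd]
  simp

theorem apply_vert : T T.vert = WithLp.toLp 2 (0, 1) := by simp [vert]

@[simp] theorem fst_graphPt (a : Euc (n - 1)) : (T (T.graphPt g a)).fst = a := by
  simp [graphPt]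

@[simp] theorem snd_graphPt (a : Euc (n - 1)) : (T (T.graphPt g a)).snd = g a := by
  simp [graphPt]

@[simp] theorem fst_shear (z : Euc (n - 1) × ℝ) : (T (T.shear g z)).fst = z.1 := by
  simp [shear]

@[simp] theorem snd_shear (z : Euc (n - 1) × ℝ) : (T (T.shear g z)).snd = g z.1 + z.2 := by
  simp [shear]

theorem shear_coords (y : Euc n) :
    T.shear g ((T y).fst, (T y).snd - g (T y).fst) = y := by
  apply T.injective
  simp only [shear, LinearIsometryEquiv.apply_symm_apply]
  apply (WithLp.equiv 2 _).injective
  simp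
  rfl

theorem norm_fst_sub_le (x y : Euc n) : ‖(T x).fst - (T y).fst‖ ≤ ‖x - y‖ := by
  rw [← WithLp.sub_fst, ← map_sub, ← T.norm_map (x - y)]
  exact WithLp.norm_fst_le (p := 2) _ _

theorem abs_snd_sub_le (x y : Euc n) : |(T x).snd - (T y).snd| ≤ ‖x - y‖ := by
  rw [← Real.norm_eq_abs, ← WithLp.sub_snd, ← map_sub, ← T.norm_map (x - y)]
  exact WithLp.norm_snd_le (p := 2) _ _

variable {T g}

theorem lipschitzWith_graphPt {K : NNReal} (hg : LipschitzWith K g) :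
    LipschitzWith (1 + K) (T.graphPt g) := by
  refine LipschitzWith.of_dist_le_mul fun a b => ?_
  rw [dist_eq_norm, graphPt, graphPt, ← map_sub, LinearIsometryEquiv.norm_map]
  have h : WithLp.toLp 2 (a, g a) - WithLp.toLp 2 (b, g b) =
      (WithLp.toLp 2 (a - b, 0) + WithLp.toLp 2 (0, g a - g b) :
        WithLp 2 (Euc (n - 1) × ℝ)) := by
    apply (WithLp.equiv 2 _).injective
    simp
  rw [h]
  refine (norm_add_le _ _).trans ?_
  rw [WithLp.norm_toLp_fst, WithLp.norm_toLp_snd, ← dist_eq_norm, ← dist_eq_norm]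
  have := hg.dist_le_mul a b
  push_cast
  linarith

theorem measurePreserving_shear (hg : Continuous g) :
    MeasurePreserving (T.shear g) volume volume := by
  have h1 : MeasurePreserving (fun z : Euc (n - 1) × ℝ => (z.1, g z.1 + z.2))
      (volume.prod volume) (volume.prod volume) :=
    MeasurePreserving.skew_product (g := fun a s => g a + s) (MeasurePreserving.id volume)
      (by fun_prop) (Eventually.of_forall fun a => (measurePreserving_add_left volume (g a)).map_eq)
  exact (T.symm.measurePreserving.comp (WithLp.volume_preserving_toLp (Euc (n - 1)) ℝ)).comp h1

end GraphCoord

/-- Near `x₀` the set `Ω` is the region above the graph of the (globally defined) Lipschitz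
function `g` in the coordinates `T`, and `∂Ω` is this graph. -/
structure IsGraphChart (Ω : Set (Euc n)) (x₀ : Euc n) (T : GraphCoord n) (K : NNReal)
    (g : Euc (n - 1) → ℝ) (r : ℝ) : Prop where
  pos : 0 < r
  lipschitz : LipschitzWith K g
  mem_iff : ∀ y ∈ Metric.ball x₀ r, (y ∈ Ω ↔ g (T y).fst < (T y).snd)
  mem_frontier_iff : ∀ y ∈ Metric.ball x₀ r, (y ∈ frontier Ω ↔ g (T y).fst = (T y).snd)

theorem HasLipschitzBoundary.exists_isGraphChart {Ω : Set (Euc n)} (hΩ : HasLipschitzBoundary Ω)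
    {x₀ : Euc n} (hx : x₀ ∈ frontier Ω) :
    ∃ (T : GraphCoord n) (K : NNReal) (g : Euc (n - 1) → ℝ) (r : ℝ), IsGraphChart Ω x₀ T K g r := by
  obtain ⟨T, δ, δ', K, γ, hδ, hδ', hγ, h⟩ := hΩ x₀ hx
  obtain ⟨g, hg, hgγ⟩ := hγ.extend_real
  have key : ∀ y ∈ Metric.ball x₀ (min δ δ'), γ (T y).fst = g (T y).fst ∧
      ‖(T y).fst - (T x₀).fst‖ < δ ∧ |(T y).snd - (T x₀).snd| < δ' := by
    intro y hy
    rw [mem_ball_iff_norm] at hy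
    have h1 := (GraphCoord.norm_fst_sub_le T y x₀).trans_lt (hy.trans_le (min_le_left _ _))
    have h2 := (GraphCoord.abs_snd_sub_le T y x₀).trans_lt (hy.trans_le (min_le_right _ _))
    exact ⟨hgγ (mem_ball_iff_norm.2 h1), h1, h2⟩
  refine ⟨T, K, g, min δ δ', lt_min hδ hδ', hg, fun y hy => ?_, fun y hy => ?_⟩
  · obtain ⟨h0, h1, h2⟩ := key y hy
    rw [← h0]
    exact (h y h1 h2).1
  · obtain ⟨h0, h1, h2⟩ := key y hy
    rw [← h0]
    exact (h y h1 h2).2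

/-- The uniform interior cone property of a Lipschitz domain: near each point of the closure there
is a direction `e` in which one can move into the domain, with room around proportional to the
displacement. -/
theorem exists_interior_cone {Ω : Set (Euc n)} (hΩ : IsLipschitzDomain Ω) {x₀ : Euc n}
    (hx : x₀ ∈ closure Ω) :
    ∃ (e : Euc n) (c t₀ r : ℝ), 0 < c ∧ 0 < t₀ ∧ 0 < r ∧
      ∀ x ∈ Ω, x ∈ Metric.ball x₀ r → ∀ t, 0 < t → t < t₀ →
        Metric.ball (x + t • e) (c * t) ⊆ Ω := by
  rw [closure_eq_self_union_frontier] at hx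
  rcases hx with hx | hx
  · obtain ⟨r, hr, hb⟩ := Metric.isOpen_iff.1 hΩ.isOpen x₀ hx
    refine ⟨0, 1, r / 2, r / 2, one_pos, by positivity, by positivity, fun x _ hxb t ht htr => ?_⟩
    rw [smul_zero, add_zero, one_mul]
    refine (Metric.ball_subset_ball' ?_).trans hb
    have := Metric.mem_ball.1 hxb
    linarith
  · obtain ⟨T, K, g, r, hr, hg, hmem, -⟩ := hΩ.lipschitz.exists_isGraphChart hx
    have hK : (0 : ℝ) < 1 + K := by positivity
    -- Over a ball of radius `t / (1 + K)`, the height and `g` together vary by at most `t`.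
    refine ⟨T.vert, 1 / (1 + K), r / 4, r / 2, by positivity, by positivity, by positivity,
      fun x hxΩ hxb t ht htr y hy => ?_⟩
    rw [mem_ball_iff_norm] at hy hxb
    have hct : 1 / (1 + K) * t ≤ t := by
      rw [div_mul_eq_mul_div, one_mul]
      exact div_le_self ht.le (by simp)
    have hxr : x ∈ Metric.ball x₀ r := by rw [mem_ball_iff_norm]; linarith
    have hyr : y ∈ Metric.ball x₀ r := by
      rw [mem_ball_iff_norm]
      have h1 : y - x₀ = (y - (x + t • T.vert)) + (x - x₀) + t • T.vert := by abel
      have h2 : ‖t • T.vert‖ = t := by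
        rw [norm_smul, GraphCoord.norm_vert, mul_one, Real.norm_eq_abs, abs_of_pos ht]
      rw [h1]
      refine (norm_add₃_le).trans_lt ?_
      rw [h2]
      linarith
    rw [hmem y hyr]
    have h0 := (hmem x hxr).1 hxΩ
    have hT : T (x + t • T.vert) = WithLp.toLp 2 ((T x).fst, (T x).snd + t) := by
      rw [map_add, map_smul, GraphCoord.apply_vert]
      apply (WithLp.equiv 2 _).injective
      refine Prod.ext ?_ ?_ <;> simp
    have h1 := (GraphCoord.norm_fst_sub_le T y (x + t • T.vert)).trans hy.le
    have h2 := (GraphCoord.abs_snd_sub_le T y (x + t • T.vert)).trans_lt hy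
    rw [hT] at h1 h2
    have h3 := hg.dist_le_mul (T y).fst (T x).fst
    rw [Real.dist_eq, dist_eq_norm] at h3
    have h4 : (K : ℝ) * ‖(T y).fst - (T x).fst‖ ≤ K * (1 / (1 + K) * t) :=
      mul_le_mul_of_nonneg_left h1 K.2
    have h5 : (K : ℝ) * (1 / (1 + K) * t) + 1 / (1 + K) * t = t := by
      field_simp
      ring
    have h6 := abs_lt.1 h2
    have h7 := abs_le.1 (h3.trans h4)
    have h8 : -(1 / (1 + K) * t) < (T y).snd - ((T x).snd + t) := h6.1
    linarith [h7.2]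

variable {Ω : Set (Euc n)} {x₀ : Euc n} {T : GraphCoord n} {K : NNReal} {g : Euc (n - 1) → ℝ}
  {r : ℝ}

theorem LipschitzOnWith.euclideanHausdorffMeasure_image_le {X Y : Type*} [MetricSpace X]
    [MetricSpace Y] [MeasurableSpace X] [BorelSpace X] [MeasurableSpace Y] [BorelSpace Y]
    {K : NNReal} {f : X → Y} {s : Set X} (h : LipschitzOnWith K f s) (d : ℕ) :
    (Measure.euclideanHausdorffMeasure d : Measure Y) (f '' s) ≤
      (K ^ d : NNReal) * (Measure.euclideanHausdorffMeasure d : Measure X) s := by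
  have h1 := h.hausdorffMeasure_image_le (d := d) (by positivity)
  simp only [Measure.euclideanHausdorffMeasure_def, Measure.smul_apply, ENNReal.smul_def,
    smul_eq_mul]
  rw [ENNReal.rpow_natCast] at h1
  push_cast
  rw [mul_left_comm]
  gcongr

/-- In a chart, surface measure is at most a multiple of Lebesgue measure of the base. -/
theorem IsGraphChart.surfaceMeasure_le (h : IsGraphChart Ω x₀ T K g r) :
    (surfaceMeasure Ω).restrict (Metric.ball x₀ r) ≤
      (((1 + K) ^ (n - 1) : NNReal) : ENNReal) • Measure.map (T.graphPt g) volume := by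
  have hL := GraphCoord.lipschitzWith_graphPt (T := T) h.lipschitz
  refine Measure.le_iff.2 fun A hA => ?_
  rw [Measure.restrict_apply hA, surfaceMeasure,
    Measure.restrict_apply (hA.inter Metric.isOpen_ball.measurableSet), Measure.smul_apply,
    Measure.map_apply hL.continuous.measurable hA, smul_eq_mul,
    ← EuclideanSpace.euclideanHausdorffMeasure_eq_volume]
  refine (measure_mono ?_).trans (hL.lipschitzOnWith.euclideanHausdorffMeasure_image_le (n - 1))
  rintro y ⟨⟨hyA, hyb⟩, hyf⟩
  have h1 : T.graphPt g (T y).fst = y := by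
    have := GraphCoord.shear_coords T g y
    rw [← (h.mem_frontier_iff y hyb).1 hyf, sub_self] at this
    rw [← this, GraphCoord.shear_eq]
    simp
  refine ⟨(T y).fst, ?_, h1⟩
  rw [Set.mem_preimage, h1]
  exact hyA

/-- In a chart, surface measure is at least Lebesgue measure of the base. -/
theorem IsGraphChart.le_surfaceMeasure (h : IsGraphChart Ω x₀ T K g r) :
    (Measure.map (T.graphPt g) volume).restrict (Metric.ball x₀ r) ≤ surfaceMeasure Ω := by
  have hL := GraphCoord.lipschitzWith_graphPt (T := T) h.lipschitz
  have hP : LipschitzWith 1 fun y : Euc n => (T y).fst := by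
    refine LipschitzWith.of_dist_le_mul fun x y => ?_
    rw [dist_eq_norm, dist_eq_norm, NNReal.coe_one, one_mul]
    exact GraphCoord.norm_fst_sub_le T x y
  refine Measure.le_iff.2 fun A hA => ?_
  have hAb := hA.inter (Metric.isOpen_ball (x := x₀) (ε := r)).measurableSet
  rw [Measure.restrict_apply hA, Measure.map_apply hL.continuous.measurable hAb, surfaceMeasure,
    Measure.restrict_apply hA, ← EuclideanSpace.euclideanHausdorffMeasure_eq_volume]
  have h1 := hP.lipschitzOnWith (s := A ∩ frontier Ω)
    |>.euclideanHausdorffMeasure_image_le (n - 1)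
  rw [one_pow, ENNReal.coe_one, one_mul] at h1
  refine (measure_mono ?_).trans h1
  rintro a ⟨haA, hab⟩
  exact ⟨T.graphPt g a, ⟨haA, (h.mem_frontier_iff _ hab).2 (by simp)⟩, by simp⟩

theorem GraphCoord.volume_preimage_ball_lt_top (R : ℝ) :
    volume (T.graphPt g ⁻¹' Metric.ball x₀ R) < ⊤ := by
  refine (measure_mono ?_).trans_lt (measure_ball_lt_top (x := (T x₀).fst) (r := R))
  intro a ha
  rw [Set.mem_preimage, mem_ball_iff_norm] at ha
  rw [mem_ball_iff_norm]
  refine lt_of_le_of_lt ?_ ha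
  have := GraphCoord.norm_fst_sub_le T (T.graphPt g a) x₀
  rwa [GraphCoord.fst_graphPt] at this

theorem isFiniteMeasure_surfaceMeasure (hΩ : HasLipschitzBoundary Ω)
    (hb : Bornology.IsBounded Ω) : IsFiniteMeasure (surfaceMeasure Ω) := by
  have hK : IsCompact (frontier Ω) := hb.isCompact_closure.of_isClosed_subset isClosed_frontier
    frontier_subset_closure
  have h : surfaceMeasure Ω (frontier Ω) < ⊤ := by
    refine hK.measure_lt_top_of_nhdsWithin fun x hx => ?_
    obtain ⟨T, K, g, r, hc⟩ := hΩ.exists_isGraphChart hx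
    refine ⟨Metric.ball x r, mem_nhdsWithin_of_mem_nhds (Metric.ball_mem_nhds x hc.pos), ?_⟩
    have h2 := hc.surfaceMeasure_le (Metric.ball x r)
    rw [Measure.restrict_apply_self, Measure.smul_apply, smul_eq_mul,
      Measure.map_apply (GraphCoord.lipschitzWith_graphPt hc.lipschitz).continuous.measurable
        Metric.isOpen_ball.measurableSet] at h2
    exact h2.trans_lt (ENNReal.mul_lt_top ENNReal.coe_lt_top
      (GraphCoord.volume_preimage_ball_lt_top r))
  refine ⟨?_⟩
  rw [surfaceMeasure, Measure.restrict_apply_univ]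
  rwa [surfaceMeasure, Measure.restrict_apply_self] at h

end Charts

/-! ### Mollification -/

section Mollification

variable {n : ℕ} {F : Type*} [NormedAddCommGroup F] [InnerProductSpace ℝ F]

/-- The correlation `y ↦ ∫ ⟪V(x), W(x + y)⟫ dx` of two vector valued functions. -/
def crossCorr (V W : Euc n → F) (y : Euc n) : ℝ := ∫ x, ⟪V x, W (x + y)⟫_ℝ

/-- Correlations of `L²` functions are continuous, as translation is continuous in `L²`. -/
theorem continuous_crossCorr {V W : Euc n → F} (hV : MemLp V 2 volume) (hW : MemLp W 2 volume) :
    Continuous (crossCorr V W) := by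
  let tr : Euc n → C(Euc n, Euc n) := fun y => ⟨fun x => x + y, by fun_prop⟩
  have htr : Continuous tr := ContinuousMap.continuous_of_continuous_uncurry _ (by
    change Continuous fun p : Euc n × Euc n => p.2 + p.1
    fun_prop)
  have hm : ∀ y, MeasurePreserving (tr y) volume volume := fun y =>
    measurePreserving_add_right volume y
  have h1 := (continuous_const (y := hW.toLp W)).compMeasurePreservingLp htr hm (by simp)
  have h2 : crossCorr V W = fun y =>
      ⟪hV.toLp V, Lp.compMeasurePreserving (tr y) (hm y) (hW.toLp W)⟫_ℝ := by
    ext y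
    rw [L2.inner_def]
    refine integral_congr_ae ?_
    filter_upwards [hV.coeFn_toLp, Lp.coeFn_compMeasurePreserving (hW.toLp W) (hm y),
      (hm y).quasiMeasurePreserving.ae hW.coeFn_toLp] with x hx1 hx2 hx3
    rw [hx1, hx2, Function.comp_apply, hx3]
    rfl
  rw [h2]
  fun_prop

/-- Pairing `V` with a translate of the mollification of `W` mollifies the correlation of `V`
and `W`. -/
theorem integral_inner_convolution [CompleteSpace F] {V W : Euc n → F} {ρ : Euc n → ℝ}
    (hV : Integrable V) (hW : Integrable W) (hρ : Continuous ρ) (hc : HasCompactSupport ρ)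
    (y : Euc n) :
    ∫ x, ⟪V x, convolution ρ W (ContinuousLinearMap.lsmul ℝ ℝ) volume (x + y)⟫_ℝ =
      convolution ρ (crossCorr V W) (ContinuousLinearMap.lsmul ℝ ℝ) volume y := by
  have hW' : Integrable (fun z => W (y - z)) := hW.comp_sub_left y
  have hI : Integrable (fun p : Euc n × Euc n => ⟪V p.2, W (y - (p.1 - p.2))⟫_ℝ)
      (volume.prod volume) := hV.convolution_integrand (innerSL ℝ) hW'
  obtain ⟨C, hC⟩ := hρ.bounded_above_of_compact_support hc
  have hI2 : Integrable (fun p : Euc n × Euc n => ρ p.1 * ⟪V p.2, W (y - (p.1 - p.2))⟫_ℝ)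
      (volume.prod volume) :=
    hI.bdd_mul (c := C) (by fun_prop) (Eventually.of_forall fun p => hC p.1)
  calc ∫ x, ⟪V x, convolution ρ W (ContinuousLinearMap.lsmul ℝ ℝ) volume (x + y)⟫_ℝ
      = ∫ x, ∫ s, ρ s * ⟪V x, W (y - (s - x))⟫_ℝ := by
        refine integral_congr_ae (Eventually.of_forall fun x => ?_)
        simp only [convolution_def, ContinuousLinearMap.lsmul_apply]
        have hi : Integrable (fun s => ρ s • W (x + y - s)) :=
          (hW.comp_sub_left (x + y)).bdd_smul C hρ.aestronglyMeasurable
            (Eventually.of_forall hC)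
        rw [← integral_inner hi]
        refine integral_congr_ae (Eventually.of_forall fun s => ?_)
        simp only
        rw [inner_smul_right]
        congr 3
        abel
    _ = ∫ s, ∫ x, ρ s * ⟪V x, W (y - (s - x))⟫_ℝ := (integral_integral_swap hI2).symm
    _ = _ := by
        simp only [convolution_def, ContinuousLinearMap.lsmul_apply, crossCorr, smul_eq_mul]
        refine integral_congr_ae (Eventually.of_forall fun s => ?_)
        simp only
        rw [integral_const_mul]
        congr 2
        ext x
        congr 2
        abel

theorem fderiv_convolution_lsmul_apply {ρ W : Euc n → ℝ} (hρ : ContDiff ℝ ∞ ρ)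
    (hc : HasCompactSupport ρ) (hW : LocallyIntegrable W) (y v : Euc n) :
    fderiv ℝ (convolution ρ W (ContinuousLinearMap.lsmul ℝ ℝ) volume) y v =
      ∫ z, W z * fderiv ℝ ρ (y - z) v := by
  rw [← convolution_flip]
  have h := hc.hasFDerivAt_convolution_right (ContinuousLinearMap.lsmul ℝ ℝ).flip hW
    (hρ.of_le (by simp)) y
  rw [h.fderiv, convolution_precompR_apply _ hW (hc.fderiv (𝕜 := ℝ))
    (hρ.continuous_fderiv (by simp))]
  simp [convolution_def, mul_comm]

variable {Ω : Set (Euc n)}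

/-- Mollification commutes with the weak gradient, for the product of `u ∈ H¹(Ω)` with a smooth
cut-off `χ`, at the points `y` where the mollifier only sees the inside of `Ω`. -/
theorem IsWeakGradient.integral_mul_fderiv_sub {u : Euc n → ℝ} {G : Euc n → Euc n}
    (h : IsWeakGradient Ω u G) (hu : MemLp u 2 (volume.restrict Ω))
    (hG : MemLp G 2 (volume.restrict Ω)) {ρ χ : Euc n → ℝ} (hρ : ContDiff ℝ ∞ ρ)
    (hχ : ContDiff ℝ ∞ χ) (hcρ : HasCompactSupport ρ) {y : Euc n}
    (hs : tsupport (fun z => ρ (y - z) * χ z) ⊆ Ω) (i : Fin n) :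
    ∫ z in Ω, u z * χ z * fderiv ℝ ρ (y - z) (EuclideanSpace.single i 1) =
      ∫ z in Ω, ρ (y - z) * (χ z * G z i + u z * gradient χ z i) := by
  set e : Euc n := EuclideanSpace.single i 1
  have hsub : ContDiff ℝ ∞ fun z : Euc n => ρ (y - z) := by fun_prop
  have hcsub : HasCompactSupport fun z : Euc n => ρ (y - z) :=
    hcρ.comp_homeomorph (Homeomorph.subLeft y)
  have hdsub : ∀ z, fderiv ℝ (fun z : Euc n => ρ (y - z)) z e = - fderiv ℝ ρ (y - z) e := by
    intro z
    have h1 := (hρ.differentiable (by simp) (y - z)).hasFDerivAt.comp z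
      ((hasFDerivAt_id z).const_sub y)
    have h2 := h1.fderiv
    change fderiv ℝ (fun z : Euc n => ρ (y - z)) z = _ at h2
    rw [h2]
    simp
  have hd : ∀ z, fderiv ℝ (fun z => ρ (y - z) * χ z) z e =
      ρ (y - z) * gradient χ z i - χ z * fderiv ℝ ρ (y - z) e := by
    intro z
    have h1 := fderiv_fun_mul (hsub.differentiable (by simp) z) (hχ.differentiable (by simp) z)
    rw [h1, gradient_apply]
    simp only [add_apply, smul_apply, smul_eq_mul, hdsub]
    ring
  have key := h _ (hsub.mul hχ) hcsub.mul_right hs i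
  have c1 : Continuous fun z => fderiv ℝ ρ (y - z) e :=
    ((hρ.continuous_fderiv (by simp)).clm_apply continuous_const).comp (by fun_prop)
  have cs1 : HasCompactSupport fun z => fderiv ℝ ρ (y - z) e :=
    (hcρ.fderiv_apply (𝕜 := ℝ) e).comp_homeomorph (Homeomorph.subLeft y)
  have c2 : Continuous fun z => gradient χ z i := by
    simp only [gradient_apply]
    exact continuous_partial hχ _
  have i1 : Integrable (fun z => u z * (χ z * fderiv ℝ ρ (y - z) e)) (volume.restrict Ω) :=
    integrable_mul_test hu (hχ.continuous.mul c1) cs1.mul_left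
  have i2 : Integrable (fun z => u z * (ρ (y - z) * gradient χ z i)) (volume.restrict Ω) :=
    integrable_mul_test hu (hsub.continuous.mul c2) hcsub.mul_right
  have i3 : Integrable (fun z => G z i * (ρ (y - z) * χ z)) (volume.restrict Ω) :=
    integrable_mul_test (memLp_coord hG i) (hsub.continuous.mul hχ.continuous) hcsub.mul_right
  have k1 : ∫ z in Ω, u z * fderiv ℝ (fun z => ρ (y - z) * χ z) z e =
      (∫ z in Ω, u z * (ρ (y - z) * gradient χ z i)) -
        ∫ z in Ω, u z * (χ z * fderiv ℝ ρ (y - z) e) := by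
    rw [← integral_sub i2 i1]
    refine integral_congr_ae (Eventually.of_forall fun z => ?_)
    simp only [hd]
    ring
  have k2 : ∫ z in Ω, ρ (y - z) * (χ z * G z i + u z * gradient χ z i) =
      (∫ z in Ω, G z i * (ρ (y - z) * χ z)) + ∫ z in Ω, u z * (ρ (y - z) * gradient χ z i) := by
    rw [← integral_add i3 i2]
    refine integral_congr_ae (Eventually.of_forall fun z => ?_)
    simp only
    ring
  have k3 : ∫ z in Ω, u z * χ z * fderiv ℝ ρ (y - z) e =
      ∫ z in Ω, u z * (χ z * fderiv ℝ ρ (y - z) e) := by simp only [mul_assoc]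
  rw [k1] at key
  rw [k2, k3]
  linarith

end Mollification

/-! ### Orthogonality to `C¹` functions is a local condition -/

section Density

variable {n : ℕ} {Ω : Set (Euc n)}

/-- The `H¹(Ω)` inner product of `v` with `χ u`, for a smooth function `χ`. -/
def localPairing (v u : H1 Ω) (χ : Euc n → ℝ) : ℝ :=
  (∫ x in Ω, v.val x * (u.val x * χ x)) +
    ∫ x in Ω, ⟪H1.grad Ω v x, χ x • H1.grad Ω u x + u.val x • gradient χ x⟫_ℝ

theorem H1.inner_eq (v u : H1 Ω) :
    ⟪v, u⟫_ℝ = (∫ x in Ω, v.val x * u.val x) + ∫ x in Ω, ⟪H1.grad Ω v x, H1.grad Ω u x⟫_ℝ := by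
  have h : ⟪v, u⟫_ℝ = ⟪v.val, u.val⟫_ℝ + ⟪H1.grad Ω v, H1.grad Ω u⟫_ℝ :=
    WithLp.prod_inner_apply _ _
  rw [h, L2.inner_def, L2.inner_def]
  congr 1
  exact integral_congr_ae (Eventually.of_forall fun x => mul_comm _ _)

theorem memLp_smul_of_hasCompactSupport {F : Type*} [NormedAddCommGroup F] [NormedSpace ℝ F]
    {μ : Measure (Euc n)} {p : ENNReal} {f : Euc n → F} {χ : Euc n → ℝ} (hf : MemLp f p μ)
    (hχ : Continuous χ) (hc : HasCompactSupport χ) : MemLp (fun x => χ x • f x) p μ := by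
  obtain ⟨C, hC⟩ := hχ.bounded_above_of_compact_support hc
  exact hf.of_le_mul (c := C) (hχ.aestronglyMeasurable.smul hf.1) (Eventually.of_forall fun x => by
    rw [norm_smul]
    exact mul_le_mul_of_nonneg_right (hC x) (norm_nonneg _))

theorem memLp_smul_gradient {μ : Measure (Euc n)} {p : ENNReal} {f χ : Euc n → ℝ}
    (hf : MemLp f p μ) (hχ : ContDiff ℝ ∞ χ) (hc : HasCompactSupport χ) :
    MemLp (fun x => f x • gradient χ x) p μ := by
  have hcg : HasCompactSupport (gradient χ) :=
    (hc.fderiv (𝕜 := ℝ)).comp_left (g := (InnerProductSpace.toDual ℝ (Euc n)).symm) (map_zero _)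
  have hg : Continuous (gradient χ) := continuous_gradient (hχ.of_le (by simp))
  obtain ⟨C, hC⟩ := hg.bounded_above_of_compact_support hcg
  exact hf.of_le_mul (c := C) (hf.1.smul hg.aestronglyMeasurable) (Eventually.of_forall fun x => by
    rw [norm_smul, mul_comm]
    exact mul_le_mul_of_nonneg_right (hC x) (norm_nonneg _))

theorem memLp_indicator_of_restrict {F : Type*} [NormedAddCommGroup F] (hΩ : IsOpen Ω)
    {p : ENNReal} {f : Euc n → F} (hf : MemLp f p (volume.restrict Ω)) :
    MemLp (Ω.indicator f) p volume := (memLp_indicator_iff_restrict hΩ.measurableSet).2 hf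

theorem integrable_restrict_of_isBounded {F : Type*} [NormedAddCommGroup F]
    (hb : Bornology.IsBounded Ω) {f : Euc n → F} (hf : MemLp f 2 (volume.restrict Ω)) :
    Integrable f (volume.restrict Ω) := by
  have : IsFiniteMeasure ((volume : Measure (Euc n)).restrict Ω) :=
    ⟨by simpa using hb.measure_lt_top⟩
  exact hf.integrable (by norm_num)

theorem H1.memLp_val_mul (u : H1 Ω) {χ : Euc n → ℝ} (hχ : Continuous χ)
    (hc : HasCompactSupport χ) : MemLp (fun x => u.val x * χ x) 2 (volume.restrict Ω) := by
  have h := memLp_smul_of_hasCompactSupport (Lp.memLp u.val) hχ hc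
  refine h.congr_norm ((Lp.memLp u.val).1.mul hχ.aestronglyMeasurable)
    (Eventually.of_forall fun x => ?_)
  rw [norm_smul, norm_mul, mul_comm]

theorem H1.memLp_smul_grad_add (u : H1 Ω) {χ : Euc n → ℝ} (hχ : ContDiff ℝ ∞ χ)
    (hc : HasCompactSupport χ) :
    MemLp (fun x => χ x • H1.grad Ω u x + u.val x • gradient χ x) 2 (volume.restrict Ω) := by
  have h1 : MemLp (fun x => χ x • H1.grad Ω u x) 2 (volume.restrict Ω) :=
    memLp_smul_of_hasCompactSupport (Lp.memLp (H1.grad Ω u)) hχ.continuous hc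
  have h2 : MemLp (fun x => u.val x • gradient χ x) 2 (volume.restrict Ω) :=
    memLp_smul_gradient (Lp.memLp u.val) hχ hc
  exact h1.add h2

/-- The correlation of `v` with `χ u`, extended by zero, for the inner product of `H¹(Ω)`. -/
def pairingCorr (v u : H1 Ω) (χ : Euc n → ℝ) (y : Euc n) : ℝ :=
  crossCorr (Ω.indicator v.val) (Ω.indicator fun x => u.val x * χ x) y +
    crossCorr (Ω.indicator (H1.grad Ω v))
      (Ω.indicator fun x => χ x • H1.grad Ω u x + u.val x • gradient χ x) y

theorem continuous_pairingCorr (hΩ : IsOpen Ω) (v u : H1 Ω) {χ : Euc n → ℝ}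
    (hχ : ContDiff ℝ ∞ χ) (hc : HasCompactSupport χ) : Continuous (pairingCorr v u χ) := by
  have h0 : MemLp (Ω.indicator v.val) 2 volume :=
    memLp_indicator_of_restrict hΩ (Lp.memLp v.val)
  have h1 : MemLp (Ω.indicator (H1.grad Ω v)) 2 volume :=
    memLp_indicator_of_restrict hΩ (Lp.memLp (H1.grad Ω v))
  exact (continuous_crossCorr h0 (memLp_indicator_of_restrict hΩ
    (H1.memLp_val_mul u hχ.continuous hc))).add
    (continuous_crossCorr h1 (memLp_indicator_of_restrict hΩ (H1.memLp_smul_grad_add u hχ hc)))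

/-- If `v` is orthogonal to all `C¹` functions, then its pairing with the mollification of `χ u`,
shifted so that only values inside `Ω` enter, vanishes. -/
theorem crossCorr_convolution_eq_zero (hΩ : IsOpen Ω) (hb : Bornology.IsBounded Ω) {v u : H1 Ω}
    (hv : ∀ φ, ⟪v, H1.ofC1 hb φ⟫_ℝ = 0) {ρ χ : Euc n → ℝ} (hρ : ContDiff ℝ ∞ ρ)
    (hχ : ContDiff ℝ ∞ χ) (hcρ : HasCompactSupport ρ) (hcχ : HasCompactSupport χ) {w : Euc n}
    (hs : ∀ x ∈ Ω, tsupport (fun z => ρ (x + w - z) * χ z) ⊆ Ω) :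
    convolution ρ (pairingCorr v u χ) (ContinuousLinearMap.lsmul ℝ ℝ) volume w = 0 := by
  set W : Euc n → ℝ := Ω.indicator fun x => u.val x * χ x with hWdef
  set Z : Euc n → Euc n := Ω.indicator fun x => χ x • H1.grad Ω u x + u.val x • gradient χ x
    with hZdef
  have hWm := H1.memLp_val_mul u hχ.continuous hcχ
  have hZm := H1.memLp_smul_grad_add u hχ hcχ
  have hWi : Integrable W := (integrable_indicator_iff hΩ.measurableSet).2
    (integrable_restrict_of_isBounded hb hWm)
  have hZi : Integrable Z := (integrable_indicator_iff hΩ.measurableSet).2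
    (integrable_restrict_of_isBounded hb hZm)
  have hV0 : Integrable (Ω.indicator v.val) := (integrable_indicator_iff hΩ.measurableSet).2
    (integrable_restrict_of_isBounded hb (Lp.memLp _))
  have hV1 : Integrable (Ω.indicator (H1.grad Ω v)) :=
    (integrable_indicator_iff hΩ.measurableSet).2
      (integrable_restrict_of_isBounded hb (Lp.memLp _))
  have hC0 : Continuous (crossCorr (Ω.indicator v.val) W) :=
    continuous_crossCorr (memLp_indicator_of_restrict hΩ (Lp.memLp _))
      (memLp_indicator_of_restrict hΩ hWm)
  have hC1 : Continuous (crossCorr (Ω.indicator (H1.grad Ω v)) Z) :=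
    continuous_crossCorr (memLp_indicator_of_restrict hΩ (Lp.memLp _))
      (memLp_indicator_of_restrict hΩ hZm)
  -- The mollified function and its gradient inside `Ω`.
  set Φ : Euc n → ℝ := convolution ρ W (ContinuousLinearMap.lsmul ℝ ℝ) volume with hΦdef
  have hΦ : ContDiff ℝ ∞ Φ := hcρ.contDiff_convolution_left _ hρ hWi.locallyIntegrable
  have hφ : ContDiff ℝ 1 fun x => Φ (x + w) :=
    (hΦ.of_le (by simp)).comp (contDiff_id.add contDiff_const)
  have hgrad : ∀ x ∈ Ω, gradient (fun x => Φ (x + w)) x =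
      convolution ρ Z (ContinuousLinearMap.lsmul ℝ ℝ) volume (x + w) := by
    intro x hx
    ext i
    rw [gradient_apply, fderiv_comp_add_right,
      fderiv_convolution_lsmul_apply hρ hcρ hWi.locallyIntegrable]
    have hint : Integrable fun z => ρ (x + w - z) • Z z := by
      obtain ⟨C, hC⟩ := hρ.continuous.bounded_above_of_compact_support hcρ
      have hρ' := hρ.continuous
      exact hZi.bdd_smul C (by fun_prop) (Eventually.of_forall fun z => hC _)
    have h1 : convolution ρ Z (ContinuousLinearMap.lsmul ℝ ℝ) volume (x + w) =
        ∫ z, ρ (x + w - z) • Z z := convolution_eq_swap _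
    have h2 : (∫ z, ρ (x + w - z) • Z z) i = ∫ z, ρ (x + w - z) * Z z i :=
      ((EuclideanSpace.proj (𝕜 := ℝ) i).integral_comp_comm hint).symm
    rw [h1, h2]
    have h3 : ∀ z, W z * fderiv ℝ ρ (x + w - z) (EuclideanSpace.single i 1) = Ω.indicator
        (fun z => u.val z * χ z * fderiv ℝ ρ (x + w - z) (EuclideanSpace.single i 1)) z := by
      intro z
      rw [Set.indicator_mul_left]
    have h4 : ∀ z, ρ (x + w - z) * Z z i = Ω.indicator (fun z => ρ (x + w - z) *
        (χ z * H1.grad Ω u z i + u.val z * gradient χ z i)) z := by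
      intro z
      by_cases hz : z ∈ Ω
      · simp [hZdef, hz]
      · simp [hZdef, hz]
    simp only [h3, h4]
    rw [integral_indicator hΩ.measurableSet, integral_indicator hΩ.measurableSet]
    have hw : IsWeakGradient Ω u.val (H1.grad Ω u) := u.2
    exact hw.integral_mul_fderiv_sub (Lp.memLp _) (Lp.memLp _) hρ hχ hcρ (hs x hx) i
  have h0 := hv ⟨fun x => Φ (x + w), hφ⟩
  rw [H1.inner_eq] at h0
  have e0 : ∫ x in Ω, v.val x * (H1.ofC1 hb ⟨fun x => Φ (x + w), hφ⟩).val x =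
      convolution ρ (crossCorr (Ω.indicator v.val) W) (ContinuousLinearMap.lsmul ℝ ℝ)
        volume w := by
    rw [← integral_inner_convolution hV0 hWi hρ.continuous hcρ, ← integral_indicator
      hΩ.measurableSet]
    have h5 := (ae_restrict_iff' hΩ.measurableSet).1 (H1.ofC1_val hb ⟨fun x => Φ (x + w), hφ⟩)
    refine integral_congr_ae ?_
    filter_upwards [h5] with x hx
    by_cases hxΩ : x ∈ Ω
    · simp only [Set.indicator_of_mem hxΩ]
      rw [hx hxΩ, mul_comm]
      rfl
    · simp [hxΩ]
  have e1 : ∫ x in Ω, ⟪H1.grad Ω v x, H1.grad Ω (H1.ofC1 hb ⟨fun x => Φ (x + w), hφ⟩) x⟫_ℝ =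
      convolution ρ (crossCorr (Ω.indicator (H1.grad Ω v)) Z) (ContinuousLinearMap.lsmul ℝ ℝ)
        volume w := by
    rw [← integral_inner_convolution hV1 hZi hρ.continuous hcρ, ← integral_indicator
      hΩ.measurableSet]
    have h5 := (ae_restrict_iff' hΩ.measurableSet).1 (H1.ofC1_grad hb ⟨fun x => Φ (x + w), hφ⟩)
    refine integral_congr_ae ?_
    filter_upwards [h5] with x hx
    by_cases hxΩ : x ∈ Ω
    · simp only [Set.indicator_of_mem hxΩ]
      rw [hx hxΩ, ← hgrad x hxΩ]
    · simp [hxΩ]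
  rw [e0, e1] at h0
  rw [← h0]
  exact ConvolutionExistsAt.distrib_add
    (hcρ.convolutionExists_left _ hρ.continuous hC0.locallyIntegrable w)
    (hcρ.convolutionExists_left _ hρ.continuous hC1.locallyIntegrable w)

theorem localPairing_eq_pairingCorr (hΩ : IsOpen Ω) (v u : H1 Ω) (χ : Euc n → ℝ) :
    localPairing v u χ = pairingCorr v u χ 0 := by
  unfold localPairing pairingCorr crossCorr
  rw [← integral_indicator hΩ.measurableSet, ← integral_indicator hΩ.measurableSet]
  congr 1
  · refine integral_congr_ae (Eventually.of_forall fun x => ?_)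
    by_cases hx : x ∈ Ω
    · simp [hx, mul_comm]
    · simp [hx]
  · refine integral_congr_ae (Eventually.of_forall fun x => ?_)
    by_cases hx : x ∈ Ω
    · simp [hx]
    · simp [hx]

/-- An element of `H¹(Ω)` orthogonal to all `C¹` functions is locally orthogonal to everything. -/
theorem exists_localPairing_eq_zero (hΩ : IsLipschitzDomain Ω) (hb : Bornology.IsBounded Ω)
    {v u : H1 Ω} (hv : ∀ φ, ⟪v, H1.ofC1 hb φ⟫_ℝ = 0) {x₀ : Euc n} (hx₀ : x₀ ∈ closure Ω) :
    ∃ r, 0 < r ∧ ∀ χ : Euc n → ℝ, ContDiff ℝ ∞ χ → HasCompactSupport χ →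
      tsupport χ ⊆ Metric.ball x₀ r → localPairing v u χ = 0 := by
  obtain ⟨e, c, t₀, r, hc, ht₀, hr, hcone⟩ := exists_interior_cone hΩ hx₀
  refine ⟨r / 2, by positivity, fun χ hχ hcχ hsχ => ?_⟩
  rw [localPairing_eq_pairingCorr hΩ.isOpen]
  have hA := continuous_pairingCorr hΩ.isOpen v u hχ hcχ
  set A := pairingCorr v u χ with hAdef
  -- Mollifiers of radius proportional to the inward shift.
  let t : ℕ → ℝ := fun k => 1 / ((k : ℝ) + 1)
  have htpos : ∀ k, 0 < t k := fun k => Nat.one_div_pos_of_nat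
  have htlim : Tendsto t atTop (𝓝 0) := tendsto_one_div_add_atTop_nhds_zero_nat
  let b : ℕ → ContDiffBump (0 : Euc n) := fun k =>
    ⟨c * t k / 4, c * t k / 2, by have := htpos k; positivity, by
      have := mul_pos hc (htpos k); linarith⟩
  have hlim : Tendsto (fun k => convolution ((b k).normed volume) A
      (ContinuousLinearMap.lsmul ℝ ℝ) volume (t k • e)) atTop (𝓝 (A 0)) := by
    refine ContDiffBump.convolution_tendsto_right (g := fun _ => A) ?_
      (Eventually.of_forall fun _ => hA.aestronglyMeasurable) ?_ (x₀ := 0) ?_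
    · have h1 : Tendsto (fun k => c * t k / 2) atTop (𝓝 (c * 0 / 2)) :=
        (htlim.const_mul c).div_const 2
      simpa using h1
    · exact (hA.tendsto 0).comp tendsto_snd
    · simpa using htlim.smul_const e
  have hzero : ∀ᶠ k in atTop, convolution ((b k).normed volume) A
      (ContinuousLinearMap.lsmul ℝ ℝ) volume (t k • e) = 0 := by
    have h1 : ∀ᶠ k in atTop, t k < t₀ := htlim.eventually_lt_const ht₀
    have h2 : ∀ᶠ k in atTop, t k * (‖e‖ + c) < r / 2 := by
      have : Tendsto (fun k => t k * (‖e‖ + c)) atTop (𝓝 (0 * (‖e‖ + c))) := htlim.mul_const _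
      rw [zero_mul] at this
      exact this.eventually_lt_const (by positivity)
    filter_upwards [h1, h2] with k hk1 hk2
    refine crossCorr_convolution_eq_zero hΩ.isOpen hb hv (b k).contDiff_normed hχ
      (b k).hasCompactSupport_normed hcχ fun x hx z hz => ?_
    have hct := mul_pos hc (htpos k)
    have hz1 : z ∈ tsupport χ := tsupport_mul_subset_right hz
    have hz2 : z ∈ Metric.closedBall (x + t k • e) (c * t k / 2) := by
      have h3 : tsupport (fun z => (b k).normed volume (x + t k • e - z)) ⊆
          Metric.closedBall (x + t k • e) (c * t k / 2) := by
        refine closure_minimal (fun z hz => ?_) Metric.isClosed_closedBall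
        have h4 : x + t k • e - z ∈ Function.support ((b k).normed volume) := hz
        rw [(b k).support_normed_eq, mem_ball_zero_iff] at h4
        rw [mem_closedBall_iff_norm, norm_sub_rev]
        exact h4.le
      exact h3 (tsupport_mul_subset_left hz)
    have hz3 := mem_ball_iff_norm.1 (hsχ hz1)
    rw [mem_closedBall_iff_norm] at hz2
    have hxr : x ∈ Metric.ball x₀ r := by
      rw [mem_ball_iff_norm]
      have h5 : x - x₀ = -(z - (x + t k • e)) + (z - x₀) + -(t k • e) := by abel
      rw [h5]
      refine norm_add₃_le.trans_lt ?_
      rw [norm_neg, norm_neg, norm_smul, Real.norm_eq_abs, abs_of_pos (htpos k)]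
      linarith
    refine hcone x hx hxr (t k) (htpos k) hk1 ?_
    rw [mem_ball_iff_norm]
    linarith
  exact tendsto_nhds_unique hlim (tendsto_const_nhds.congr' (hzero.mono fun k hk => hk.symm))

end Density

/-! ### Density of `C¹` functions in `H¹(Ω)` -/

section Density

variable {n : ℕ} {Ω : Set (Euc n)}

theorem localPairing_eq_integral (v u : H1 Ω) {χ : Euc n → ℝ}
    (hχ : ContDiff ℝ ∞ χ) (hc : HasCompactSupport χ) :
    Integrable (fun x => v.val x * (u.val x * χ x) +
      ⟪H1.grad Ω v x, χ x • H1.grad Ω u x + u.val x • gradient χ x⟫_ℝ) (volume.restrict Ω) ∧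
    localPairing v u χ = ∫ x in Ω, v.val x * (u.val x * χ x) +
      ⟪H1.grad Ω v x, χ x • H1.grad Ω u x + u.val x • gradient χ x⟫_ℝ := by
  have h1 : Integrable (fun x => v.val x * (u.val x * χ x)) (volume.restrict Ω) :=
    MemLp.integrable_mul (p := 2) (q := 2) (Lp.memLp v.val) (H1.memLp_val_mul u hχ.continuous hc)
  have h2 : Integrable (fun x => ⟪H1.grad Ω v x, χ x • H1.grad Ω u x + u.val x • gradient χ x⟫_ℝ)
      (volume.restrict Ω) := by
    have h3 := H1.memLp_smul_grad_add u hχ hc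
    have h4 := L2.integrable_inner (𝕜 := ℝ) (H1.grad Ω v) (h3.toLp _)
    refine h4.congr ?_
    filter_upwards [h3.coeFn_toLp] with x hx
    rw [hx]
  exact ⟨h1.add h2, (integral_add h1 h2).symm⟩

theorem denseRange_of_forall_inner_eq_zero {E V : Type*} [NormedAddCommGroup E]
    [InnerProductSpace ℝ E] [CompleteSpace E] [AddCommGroup V] [Module ℝ V] (f : V →ₗ[ℝ] E)
    (h : ∀ v, (∀ φ, ⟪v, f φ⟫_ℝ = 0) → v = 0) : DenseRange f := by
  have hbot : (LinearMap.range f)ᗮ = ⊥ := by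
    rw [Submodule.eq_bot_iff]
    intro v hv
    refine h v fun φ => ?_
    rw [real_inner_comm]
    exact hv _ ⟨φ, rfl⟩
  have hd : Dense (LinearMap.range f : Set E) :=
    Submodule.dense_iff_topologicalClosure_eq_top.2
      (Submodule.topologicalClosure_eq_top_iff.2 hbot)
  rwa [LinearMap.coe_range] at hd

/-- The functions of class `C¹` on `ℝⁿ` are dense in `H¹(Ω)` for a bounded Lipschitz domain. -/
theorem denseRange_ofC1 (hΩ : IsLipschitzDomain Ω) (hb : Bornology.IsBounded Ω) :
    DenseRange (H1.ofC1 hb) := by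
  refine denseRange_of_forall_inner_eq_zero _ fun v hv' => ?_
  choose! r hr hloc using fun x (hx : x ∈ closure Ω) =>
    exists_localPairing_eq_zero hΩ hb (u := v) hv' hx
  obtain ⟨t, htΩ, htc⟩ := hb.isCompact_closure.elim_nhds_subcover (fun x => Metric.ball x (r x))
    (fun x hx => Metric.ball_mem_nhds x (hr x hx))
  obtain ⟨f, hf⟩ := SmoothPartitionOfUnity.exists_isSubordinate
    (modelWithCornersSelf ℝ (Euc n)) (isClosed_closure (s := Ω))
    (fun i : t => Metric.ball (i : Euc n) (r i)) (fun i => Metric.isOpen_ball)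
    (fun x hx => by
      obtain ⟨i, hi, hxi⟩ := Set.mem_iUnion₂.1 (htc hx)
      exact Set.mem_iUnion.2 ⟨⟨i, hi⟩, hxi⟩)
  have hsm : ∀ i, ContDiff ℝ ∞ (f i) := fun i => (f i).contMDiff.contDiff
  have hcs : ∀ i, HasCompactSupport (f i) := fun i =>
    HasCompactSupport.of_support_subset_isCompact
      (isCompact_closedBall (i : Euc n) (r i))
      ((subset_tsupport _).trans ((hf i).trans Metric.ball_subset_closedBall))
  have hzero : ∀ i, localPairing v v (f i) = 0 := fun i =>
    hloc i (htΩ i i.2) (f i) (hsm i) (hcs i) (hf i)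
  have hone : ∀ x ∈ Ω, ∑ i, f i x = 1 := fun x hx => by
    rw [← finsum_eq_sum_of_fintype]
    exact f.sum_eq_one (subset_closure hx)
  have hgrad : ∀ x ∈ Ω, ∑ i, gradient (f i) x = 0 := fun x hx => by
    have h1 : HasGradientAt (fun y => ∑ i, f i y) (∑ i, gradient (f i) x) x := by
      rw [hasGradientAt_iff_hasFDerivAt, map_sum]
      refine HasFDerivAt.fun_sum fun i _ => ?_
      exact ((hsm i).differentiable (by simp) x).hasGradientAt.hasFDerivAt
    have h2 : (fun y => ∑ i, f i y) =ᶠ[𝓝 x] fun _ => (1 : ℝ) :=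
      (hΩ.isOpen.eventually_mem hx).mono fun y hy => hone y hy
    have h3 := (hasGradientAt_const x (1 : ℝ)).congr_of_eventuallyEq h2
    exact h1.unique h3
  have hvv : Integrable (fun x => v.val x * v.val x) (volume.restrict Ω) :=
    MemLp.integrable_mul (p := 2) (q := 2) (Lp.memLp v.val) (Lp.memLp v.val)
  have hsum : ⟪v, v⟫_ℝ = ∑ i, localPairing v v (f i) := by
    have h0 : ∀ i, localPairing v v (f i) = _ := fun i =>
      (localPairing_eq_integral v v (hsm i) (hcs i)).2
    simp only [h0]
    rw [← integral_finsetSum _ fun i _ =>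
      (localPairing_eq_integral v v (hsm i) (hcs i)).1, H1.inner_eq,
      ← integral_add hvv (L2.integrable_inner (𝕜 := ℝ) (H1.grad Ω v) (H1.grad Ω v))]
    refine setIntegral_congr_fun hΩ.isOpen.measurableSet fun x hx => ?_
    simp only [Finset.sum_add_distrib, ← inner_sum, ← Finset.mul_sum, ← Finset.sum_smul,
      ← Finset.smul_sum]
    rw [hone x hx, hgrad x hx, mul_one, one_smul, smul_zero, add_zero]
  rw [Finset.sum_eq_zero fun i _ => hzero i] at hsum
  exact inner_self_eq_zero.1 hsum

end Density

/-! ### The trace inequality -/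

section TraceInequality

variable {n : ℕ} {Ω : Set (Euc n)} {x₀ : Euc n} {T : GraphCoord n} {K : NNReal}
  {g : Euc (n - 1) → ℝ} {r : ℝ}

theorem hasCompactSupport_comp_graphPt {f : Euc n → ℝ} (hs : tsupport f ⊆ Metric.ball x₀ r) :
    HasCompactSupport fun a => f (T.graphPt g a) := by
  refine HasCompactSupport.of_support_subset_isCompact
    (isCompact_closedBall (T x₀).fst r) fun a ha => ?_
  have h1 := hs (subset_tsupport f (show T.graphPt g a ∈ Function.support f from ha))
  rw [mem_ball_iff_norm] at h1
  rw [mem_closedBall_iff_norm]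
  have h2 := GraphCoord.norm_fst_sub_le T (T.graphPt g a) x₀
  rw [GraphCoord.fst_graphPt] at h2
  exact h2.trans h1.le

/-- The divergence theorem above a Lipschitz graph, in the vertical direction. -/
theorem IsGraphChart.integral_fderiv_vert (h : IsGraphChart Ω x₀ T K g r) (hΩ : IsOpen Ω)
    {f : Euc n → ℝ} (hf : ContDiff ℝ 1 f) (hc : HasCompactSupport f)
    (hs : tsupport f ⊆ Metric.ball x₀ r) :
    ∫ x in Ω, fderiv ℝ f x T.vert = - ∫ a, f (T.graphPt g a) := by
  have hgc := h.lipschitz.continuous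
  have hD : Continuous fun x => fderiv ℝ f x T.vert :=
    (hf.continuous_fderiv one_ne_zero).clm_apply continuous_const
  have hDi : Integrable (fun x => fderiv ℝ f x T.vert) :=
    hD.integrable_of_hasCompactSupport (hc.fderiv_apply (𝕜 := ℝ) _)
  have hmp := GraphCoord.measurePreserving_shear (T := T) hgc
  have hind : ∀ z : Euc (n - 1) × ℝ,
      Ω.indicator (fun x => fderiv ℝ f x T.vert) (T.shear g z) =
        (Set.Ioi (0 : ℝ)).indicator (fun s => fderiv ℝ f (T.shear g (z.1, s)) T.vert) z.2 := by
    intro z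
    by_cases hz : T.shear g z ∈ Metric.ball x₀ r
    · have h1 : T.shear g z ∈ Ω ↔ z.2 ∈ Set.Ioi (0 : ℝ) := by
        rw [h.mem_iff _ hz]
        simp
      by_cases h2 : z.2 ∈ Set.Ioi (0 : ℝ)
      · rw [Set.indicator_of_mem h2, Set.indicator_of_mem (h1.2 h2)]
      · rw [Set.indicator_of_notMem h2, Set.indicator_of_notMem (fun h3 => h2 (h1.1 h3))]
    · have h0 : fderiv ℝ f (T.shear g z) = 0 := by
        by_contra h1
        exact hz (hs (tsupport_fderiv_subset ℝ (subset_tsupport _ h1)))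
      simp only [Set.indicator, h0, zero_apply, ite_self]
  have hint : Integrable (fun z : Euc (n - 1) × ℝ =>
      Ω.indicator (fun x => fderiv ℝ f x T.vert) (T.shear g z)) (volume.prod volume) :=
    hmp.integrable_comp_of_integrable (hDi.indicator hΩ.measurableSet)
  have h1d : ∀ a : Euc (n - 1), ∫ s in Set.Ioi (0 : ℝ), fderiv ℝ f (T.shear g (a, s)) T.vert =
      - f (T.graphPt g a) := by
    intro a
    have hl : ∀ s : ℝ, HasDerivAt (fun s : ℝ => T.graphPt g a + s • T.vert) T.vert s := fun s => by
      simpa using ((hasDerivAt_id s).smul_const T.vert).const_add (T.graphPt g a)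
    have hd : ∀ s, deriv (fun s : ℝ => f (T.graphPt g a + s • T.vert)) s =
        fderiv ℝ f (T.shear g (a, s)) T.vert := fun s => by
      rw [GraphCoord.shear_eq]
      exact ((hf.differentiable one_ne_zero _).hasFDerivAt.comp_hasDerivAt s (hl s)).deriv
    have hemb : Isometry fun s : ℝ => T.graphPt g a + s • T.vert := by
      refine Isometry.of_dist_eq fun s t => ?_
      rw [dist_add_left, dist_eq_norm, ← sub_smul, norm_smul, GraphCoord.norm_vert, mul_one,
        dist_eq_norm]
    have hcd : ContDiff ℝ 1 fun s : ℝ => f (T.graphPt g a + s • T.vert) :=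
      hf.comp (contDiff_const.add (contDiff_id.smul contDiff_const))
    have := HasCompactSupport.integral_Ioi_deriv_eq hcd
      (hc.comp_isClosedEmbedding hemb.isClosedEmbedding) 0
    simp only [hd, zero_smul, add_zero] at this
    exact this
  rw [← integral_indicator hΩ.measurableSet, ← hmp.map_eq, integral_map hmp.measurable.aemeasurable
    (by rw [hmp.map_eq]; exact (hDi.indicator hΩ.measurableSet).aestronglyMeasurable)]
  change ∫ z : Euc (n - 1) × ℝ, _ ∂(volume.prod volume) = _
  rw [integral_prod _ hint, ← integral_neg]
  refine integral_congr_ae (Eventually.of_forall fun a => ?_)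
  simp only [hind]
  rw [integral_indicator measurableSet_Ioi]
  exact h1d a

theorem IsGraphChart.integral_surfaceMeasure_le (h : IsGraphChart Ω x₀ T K g r)
    {f : Euc n → ℝ} (hf : Continuous f) (h0 : ∀ x, 0 ≤ f x)
    (hs : tsupport f ⊆ Metric.ball x₀ r) :
    ∫ x, f x ∂(surfaceMeasure Ω) ≤ (1 + K) ^ (n - 1) * ∫ a, f (T.graphPt g a) := by
  have hgp := (GraphCoord.lipschitzWith_graphPt (T := T) h.lipschitz).continuous
  have hi : Integrable f (Measure.map (T.graphPt g) volume) := by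
    rw [integrable_map_measure hf.aestronglyMeasurable hgp.aemeasurable]
    exact (hf.comp hgp).integrable_of_hasCompactSupport (hasCompactSupport_comp_graphPt hs)
  have h1 : ∫ x, f x ∂(surfaceMeasure Ω) = ∫ x in Metric.ball x₀ r, f x ∂(surfaceMeasure Ω) := by
    rw [setIntegral_eq_integral_of_forall_compl_eq_zero]
    intro x hx
    by_contra hne
    exact hx (hs (subset_tsupport f hne))
  rw [h1]
  refine (integral_mono_measure h.surfaceMeasure_le (Eventually.of_forall h0)
    (hi.smul_measure ENNReal.coe_ne_top)).trans_eq ?_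
  rw [integral_smul_measure, integral_map hgp.aemeasurable hf.aestronglyMeasurable,
    ENNReal.coe_toReal]
  simp

theorem norm_gradient {φ : Euc n → ℝ} (x : Euc n) : ‖gradient φ x‖ = ‖fderiv ℝ φ x‖ :=
  LinearIsometryEquiv.norm_map _ _

theorem integrable_sq_restrict (hb : Bornology.IsBounded Ω) {φ : Euc n → ℝ}
    (hφ : ContDiff ℝ 1 φ) :
    Integrable (fun x => φ x ^ 2) (volume.restrict Ω) ∧
      Integrable (fun x => ‖gradient φ x‖ ^ 2) (volume.restrict Ω) := by
  have h1 := hφ.continuous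
  have h2 := continuous_gradient hφ
  exact ⟨memLp_one_iff_integrable.1 (Continuous.memLp_restrict_of_isBounded hb (by fun_prop)),
    memLp_one_iff_integrable.1 (Continuous.memLp_restrict_of_isBounded hb (by fun_prop))⟩

/-- The trace inequality near a boundary point: the divergence theorem above the graph is applied to
`χ φ²` for a cut-off function `χ`. -/
theorem exists_local_trace_inequality (hΩ : IsLipschitzDomain Ω) (hb : Bornology.IsBounded Ω)
    (hx : x₀ ∈ frontier Ω) :
    ∃ ρ C : ℝ, 0 < ρ ∧ 0 ≤ C ∧ ∀ φ : Euc n → ℝ, ContDiff ℝ 1 φ →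
      ∫⁻ x in Metric.ball x₀ ρ, ENNReal.ofReal (φ x ^ 2) ∂(surfaceMeasure Ω) ≤
        ENNReal.ofReal (C * ((∫ x in Ω, φ x ^ 2) + ∫ x in Ω, ‖gradient φ x‖ ^ 2)) := by
  obtain ⟨T, K, g, r, h⟩ := hΩ.lipschitz.exists_isGraphChart hx
  have hfin := isFiniteMeasure_surfaceMeasure hΩ.lipschitz hb
  have hr := h.pos
  let χ : ContDiffBump x₀ := ⟨r / 4, r / 2, by positivity, by linarith⟩
  have hχ : ContDiff ℝ 1 χ := χ.contDiff
  have hcχ : HasCompactSupport χ := χ.hasCompactSupport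
  obtain ⟨M, hM⟩ := (hχ.continuous_fderiv one_ne_zero).bounded_above_of_compact_support
    (hcχ.fderiv (𝕜 := ℝ))
  have hM0 : 0 ≤ M := (norm_nonneg _).trans (hM x₀)
  refine ⟨r / 4, (1 + K) ^ (n - 1) * (1 + M), by positivity, by positivity, fun φ hφ => ?_⟩
  set f : Euc n → ℝ := fun x => χ x * φ x ^ 2 with hfdef
  have hf : ContDiff ℝ 1 f := hχ.mul (hφ.pow 2)
  have hcf : HasCompactSupport f := hcχ.mul_right
  have hf0 : ∀ x, 0 ≤ f x := fun x => mul_nonneg χ.nonneg (sq_nonneg _)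
  have hs : tsupport f ⊆ Metric.ball x₀ r := by
    refine tsupport_mul_subset_left.trans ?_
    rw [χ.tsupport_eq]
    exact Metric.closedBall_subset_ball (by change r / 2 < r; linarith)
  have hfd : ∀ x, ‖fderiv ℝ f x T.vert‖ ≤ (1 + M) * (φ x ^ 2 + ‖gradient φ x‖ ^ 2) := by
    intro x
    have h1 := (hχ.differentiable one_ne_zero x).hasFDerivAt.mul
      ((hφ.differentiable one_ne_zero x).hasFDerivAt.pow 2)
    have h2 : fderiv ℝ f x T.vert =
        χ x * (2 * φ x * fderiv ℝ φ x T.vert) + φ x ^ 2 * fderiv ℝ χ x T.vert := by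
      have h1' : fderiv ℝ f x = _ := h1.fderiv
      rw [h1']
      simp
    have h3 : |fderiv ℝ φ x T.vert| ≤ ‖gradient φ x‖ := by
      have := (fderiv ℝ φ x).le_opNorm T.vert
      rwa [GraphCoord.norm_vert, mul_one, ← norm_gradient] at this
    have h4 : |fderiv ℝ χ x T.vert| ≤ M := by
      have := (fderiv ℝ χ x).le_opNorm T.vert
      rw [GraphCoord.norm_vert, mul_one] at this
      exact this.trans (hM x)
    rw [h2, Real.norm_eq_abs]
    refine (abs_add_le _ _).trans ?_
    have h5 : |χ x * (2 * φ x * fderiv ℝ φ x T.vert)| ≤ φ x ^ 2 + ‖gradient φ x‖ ^ 2 := by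
      rw [abs_mul, abs_of_nonneg χ.nonneg]
      refine (mul_le_of_le_one_left (abs_nonneg _) χ.le_one).trans ?_
      rw [abs_mul, abs_mul, abs_two]
      have h6 := mul_le_mul_of_nonneg_left h3 (abs_nonneg (φ x))
      have h7 := sq_nonneg (|φ x| - ‖gradient φ x‖)
      have h8 := sq_abs (φ x)
      nlinarith
    have h6 : |φ x ^ 2 * fderiv ℝ χ x T.vert| ≤ M * (φ x ^ 2 + ‖gradient φ x‖ ^ 2) := by
      rw [abs_mul, abs_of_nonneg (sq_nonneg _)]
      have h7 := mul_le_mul_of_nonneg_left h4 (sq_nonneg (φ x))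
      have h8 := mul_nonneg hM0 (sq_nonneg ‖gradient φ x‖)
      linarith
    linarith
  obtain ⟨hi1, hi2⟩ := integrable_sq_restrict hb hφ
  have key : ∫ x, f x ∂(surfaceMeasure Ω) ≤ (1 + K) ^ (n - 1) * (1 + M) *
      ((∫ x in Ω, φ x ^ 2) + ∫ x in Ω, ‖gradient φ x‖ ^ 2) := by
    refine (h.integral_surfaceMeasure_le hf.continuous hf0 hs).trans ?_
    rw [mul_assoc]
    refine mul_le_mul_of_nonneg_left ?_ (by positivity)
    have h1 := h.integral_fderiv_vert hΩ.isOpen hf hcf hs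
    have h2 := norm_integral_le_of_norm_le ((hi1.add hi2).const_mul (1 + M))
      (Eventually.of_forall hfd)
    rw [h1, norm_neg, integral_const_mul, integral_add' hi1 hi2] at h2
    exact (Real.le_norm_self _).trans h2
  refine le_trans ?_ (ENNReal.ofReal_le_ofReal key)
  rw [ofReal_integral_eq_lintegral_ofReal (hf.continuous.integrable_of_hasCompactSupport hcf)
    (Eventually.of_forall hf0)]
  refine (setLIntegral_mono_ae hf.continuous.measurable.ennreal_ofReal.aemeasurable
    (Eventually.of_forall fun x hxb => ?_)).trans
    (setLIntegral_le_lintegral (Metric.ball x₀ (r / 4)) _)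
  refine ENNReal.ofReal_le_ofReal (le_of_eq ?_)
  have h1 : χ x = 1 := χ.one_of_mem_closedBall (Metric.ball_subset_closedBall hxb)
  rw [hfdef]
  simp only
  rw [h1, one_mul]

/-- The trace inequality: on a bounded Lipschitz domain the `L²(∂Ω)` norm of a `C¹` function is
controlled by its `H¹(Ω)` norm. -/
theorem exists_trace_inequality (hΩ : IsLipschitzDomain Ω) (hb : Bornology.IsBounded Ω) :
    ∃ C : ℝ, 0 ≤ C ∧ ∀ φ : Euc n → ℝ, ContDiff ℝ 1 φ →
      ∫ x, φ x ^ 2 ∂(surfaceMeasure Ω) ≤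
        C * ((∫ x in Ω, φ x ^ 2) + ∫ x in Ω, ‖gradient φ x‖ ^ 2) := by
  have hK : IsCompact (frontier Ω) := hb.isCompact_closure.of_isClosed_subset isClosed_frontier
    frontier_subset_closure
  have key : ∃ C : ℝ, 0 ≤ C ∧ ∀ φ : Euc n → ℝ, ContDiff ℝ 1 φ →
      ∫⁻ x in frontier Ω, ENNReal.ofReal (φ x ^ 2) ∂(surfaceMeasure Ω) ≤
        ENNReal.ofReal (C * ((∫ x in Ω, φ x ^ 2) + ∫ x in Ω, ‖gradient φ x‖ ^ 2)) := by
    refine hK.induction_on (p := fun s => ∃ C : ℝ, 0 ≤ C ∧ ∀ φ : Euc n → ℝ, ContDiff ℝ 1 φ →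
      ∫⁻ x in s, ENNReal.ofReal (φ x ^ 2) ∂(surfaceMeasure Ω) ≤
        ENNReal.ofReal (C * ((∫ x in Ω, φ x ^ 2) + ∫ x in Ω, ‖gradient φ x‖ ^ 2))) ?_ ?_ ?_ ?_
    · exact ⟨0, le_rfl, fun φ _ => by simp⟩
    · rintro s t hst ⟨C, hC, h⟩
      exact ⟨C, hC, fun φ hφ => (lintegral_mono_set hst).trans (h φ hφ)⟩
    · rintro s t ⟨C, hC, h⟩ ⟨C', hC', h'⟩
      refine ⟨C + C', by positivity, fun φ hφ => (lintegral_union_le _ _ _).trans ?_⟩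
      rw [add_mul, ENNReal.ofReal_add (by positivity) (by positivity)]
      exact add_le_add (h φ hφ) (h' φ hφ)
    · intro x hx
      obtain ⟨ρ, C, hρ, hC, h⟩ := exists_local_trace_inequality hΩ hb hx
      exact ⟨Metric.ball x ρ, mem_nhdsWithin_of_mem_nhds (Metric.ball_mem_nhds x hρ), C, hC, h⟩
  obtain ⟨C, hC, h⟩ := key
  refine ⟨C, hC, fun φ hφ => ?_⟩
  have hφc := hφ.continuous
  rw [integral_eq_lintegral_of_nonneg_ae (Eventually.of_forall fun x => sq_nonneg _)
    (by fun_prop)]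
  refine ENNReal.toReal_le_of_le_ofReal (by positivity) ?_
  refine le_trans (le_of_eq ?_) (h φ hφ)
  rw [surfaceMeasure, Measure.restrict_restrict isClosed_frontier.measurableSet, Set.inter_self]

end TraceInequality

/-! ### Friedrichs' inequality -/

section Friedrichs

variable {n : ℕ} {Ω : Set (Euc n)} {x₀ : Euc n} {T : GraphCoord n} {K : NNReal}
  {g : Euc (n - 1) → ℝ} {r : ℝ}

/-- The integral of `f` over a thin neighbourhood of a boundary portion, of width `h`, is at most
a multiple of `h ∫ f dσ`, up to the oscillation `osc` of `f` at scale `h`. -/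
theorem IsGraphChart.lintegral_thickening_le (H : IsGraphChart Ω x₀ T K g r) {h : ℝ}
    (h0 : 0 < h) (hr : (1 + K) * h < r / 4) {f : Euc n → ENNReal} (hf : Measurable f)
    {osc : ENNReal} (hosc : ∀ y z, dist y z ≤ (1 + K) * h → f y ≤ f z + osc) :
    ∫⁻ x in Metric.thickening h (frontier Ω ∩ Metric.ball x₀ (r / 4)), f x ≤
      ENNReal.ofReal (2 * (1 + K) * h) *
        (∫⁻ x, f x ∂(surfaceMeasure Ω) + osc * surfaceMeasure Ω Set.univ) := by
  have hgc := H.lipschitz.continuous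
  have hgp := (GraphCoord.lipschitzWith_graphPt (T := T) H.lipschitz).continuous
  have hmp := GraphCoord.measurePreserving_shear (T := T) hgc
  set S := Metric.thickening h (frontier Ω ∩ Metric.ball x₀ (r / 4)) with hS
  have hSm : MeasurableSet S := Metric.isOpen_thickening.measurableSet
  have hB : MeasurableSet (T.graphPt g ⁻¹' Metric.ball x₀ r) :=
    hgp.measurable Metric.isOpen_ball.measurableSet
  have hpt : ∀ z : Euc (n - 1) × ℝ, S.indicator f (T.shear g z) ≤
      (T.graphPt g ⁻¹' Metric.ball x₀ r).indicator (fun a => f (T.graphPt g a) + osc) z.1 *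
        (Set.Icc (-((1 + K) * h)) ((1 + K) * h)).indicator 1 z.2 := by
    intro z
    by_cases hz : T.shear g z ∈ S
    · obtain ⟨w, ⟨hwf, hwb⟩, hw⟩ := Metric.mem_thickening_iff.1 hz
      rw [mem_ball_iff_norm] at hwb
      rw [dist_eq_norm] at hw
      have hr0 := H.pos
      have hK0 : (0 : ℝ) ≤ K := K.2
      have hKh : 0 ≤ (K : ℝ) * h := by positivity
      have hwg := (H.mem_frontier_iff w (mem_ball_iff_norm.2 (by linarith))).1 hwf
      have h1 := (GraphCoord.norm_fst_sub_le T (T.shear g z) w).trans hw.le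
      have h2 := (GraphCoord.abs_snd_sub_le T (T.shear g z) w).trans hw.le
      rw [GraphCoord.fst_shear] at h1
      rw [GraphCoord.snd_shear, ← hwg] at h2
      have h3 := H.lipschitz.dist_le_mul z.1 (T w).fst
      rw [Real.dist_eq, dist_eq_norm] at h3
      have h4 := h3.trans (mul_le_mul_of_nonneg_left h1 hK0)
      have hs : |z.2| ≤ (1 + K) * h := by
        have h5 := abs_le.1 h2
        have h6 := abs_le.1 h4
        rw [abs_le]
        constructor <;> linarith [h5.1, h5.2, h6.1, h6.2]
      have hd : dist (T.shear g z) (T.graphPt g z.1) ≤ (1 + K) * h := by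
        rw [GraphCoord.shear_eq, dist_eq_norm, add_sub_cancel_left, norm_smul,
          GraphCoord.norm_vert, mul_one]
        exact hs
      have hb : z.1 ∈ T.graphPt g ⁻¹' Metric.ball x₀ r := by
        rw [Set.mem_preimage, mem_ball_iff_norm]
        rw [dist_eq_norm] at hd
        have h5 : T.graphPt g z.1 - x₀ =
          -(T.shear g z - T.graphPt g z.1) + (T.shear g z - w) + (w - x₀) := by abel
        rw [h5]
        refine norm_add₃_le.trans_lt ?_
        rw [norm_neg]
        linarith
      rw [Set.indicator_of_mem hz, Set.indicator_of_mem hb,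
        Set.indicator_of_mem (by rw [Set.mem_Icc]; exact abs_le.1 hs), Pi.one_apply, mul_one]
      exact hosc _ _ hd
    · rw [Set.indicator_of_notMem hz]
      exact zero_le
  calc ∫⁻ x in S, f x = ∫⁻ z : Euc (n - 1) × ℝ, S.indicator f (T.shear g z) := by
        rw [← lintegral_indicator hSm, hmp.lintegral_comp (hf.indicator hSm)]
    _ ≤ ∫⁻ z : Euc (n - 1) × ℝ,
        (T.graphPt g ⁻¹' Metric.ball x₀ r).indicator (fun a => f (T.graphPt g a) + osc) z.1 *
        (Set.Icc (-((1 + K) * h)) ((1 + K) * h)).indicator 1 z.2 := lintegral_mono hpt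
    _ = (∫⁻ a in T.graphPt g ⁻¹' Metric.ball x₀ r, f (T.graphPt g a) + osc) *
        ENNReal.ofReal (2 * (1 + K) * h) := by
        change ∫⁻ z : Euc (n - 1) × ℝ, _ ∂(volume.prod volume) = _
        have hfm : Measurable fun a => f (T.graphPt g a) + osc :=
          (hf.comp hgp.measurable).add_const osc
        rw [lintegral_prod_mul (hfm.indicator hB).aemeasurable
          ((measurable_one.indicator measurableSet_Icc).aemeasurable), lintegral_indicator hB,
          lintegral_indicator_one measurableSet_Icc, Real.volume_Icc]
        congr 2
        ring
    _ ≤ _ := by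
        rw [mul_comm]
        refine mul_le_mul_of_nonneg_left ?_ zero_le
        have h1 : ∫⁻ a in T.graphPt g ⁻¹' Metric.ball x₀ r, f (T.graphPt g a) + osc =
            ∫⁻ x in Metric.ball x₀ r, f x + osc ∂(Measure.map (T.graphPt g) volume) := by
          rw [setLIntegral_map Metric.isOpen_ball.measurableSet (hf.add_const osc) hgp.measurable]
        rw [h1]
        refine (lintegral_mono' H.le_surfaceMeasure le_rfl).trans_eq ?_
        rw [lintegral_add_right _ measurable_const, lintegral_const]

/-- The thin neighbourhood estimate for the whole boundary, from finitely many charts. -/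
theorem exists_lintegral_thickening_le (hΩ : IsLipschitzDomain Ω)
    (hb : Bornology.IsBounded Ω) :
    ∃ L D h₀ : ℝ, 0 ≤ L ∧ 0 ≤ D ∧ 0 < h₀ ∧ ∀ h, 0 < h → h < h₀ →
      ∀ (f : Euc n → ENNReal) (osc : ENNReal), Measurable f →
        (∀ y z, dist y z ≤ L * h → f y ≤ f z + osc) →
        ∫⁻ x in Metric.thickening h (frontier Ω), f x ≤ ENNReal.ofReal (D * h) *
          (∫⁻ x, f x ∂(surfaceMeasure Ω) + osc * surfaceMeasure Ω Set.univ) := by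
  have hK : IsCompact (frontier Ω) := hb.isCompact_closure.of_isClosed_subset isClosed_frontier
    frontier_subset_closure
  refine hK.induction_on (p := fun s => ∃ L D h₀ : ℝ, 0 ≤ L ∧ 0 ≤ D ∧ 0 < h₀ ∧
    ∀ h, 0 < h → h < h₀ → ∀ (f : Euc n → ENNReal) (osc : ENNReal), Measurable f →
        (∀ y z, dist y z ≤ L * h → f y ≤ f z + osc) →
        ∫⁻ x in Metric.thickening h s, f x ≤ ENNReal.ofReal (D * h) *
          (∫⁻ x, f x ∂(surfaceMeasure Ω) + osc * surfaceMeasure Ω Set.univ)) ?_ ?_ ?_ ?_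
  · exact ⟨0, 0, 1, le_rfl, le_rfl, one_pos, fun h _ _ f osc _ _ => by simp⟩
  · rintro s t hst ⟨L, D, h₀, hL, hD, hh₀, H⟩
    exact ⟨L, D, h₀, hL, hD, hh₀, fun h hp hlt f osc hf hosc =>
      (lintegral_mono_set (Metric.thickening_subset_of_subset h hst)).trans
        (H h hp hlt f osc hf hosc)⟩
  · rintro s t ⟨L, D, h₀, hL, hD, hh₀, H⟩ ⟨L', D', h₀', hL', hD', hh₀', H'⟩
    refine ⟨max L L', D + D', min h₀ h₀', le_max_of_le_left hL, add_nonneg hD hD',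
      lt_min hh₀ hh₀', fun h hp hlt f osc hf hosc => ?_⟩
    rw [Metric.thickening_union]
    refine (lintegral_union_le _ _ _).trans ?_
    rw [add_mul, ENNReal.ofReal_add (by positivity) (by positivity), add_mul]
    exact add_le_add
      (H h hp (hlt.trans_le (min_le_left _ _)) f osc hf fun y z hyz => hosc y z
        (hyz.trans (mul_le_mul_of_nonneg_right (le_max_left _ _) hp.le)))
      (H' h hp (hlt.trans_le (min_le_right _ _)) f osc hf fun y z hyz => hosc y z
        (hyz.trans (mul_le_mul_of_nonneg_right (le_max_right _ _) hp.le)))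
  · intro x hx
    obtain ⟨T, K, g, r, H⟩ := hΩ.lipschitz.exists_isGraphChart hx
    have hr := H.pos
    refine ⟨frontier Ω ∩ Metric.ball x (r / 4),
      inter_mem_nhdsWithin _ (Metric.ball_mem_nhds x (by positivity)), 1 + K, 2 * (1 + K),
      r / 4 / (1 + K), by positivity, by positivity, by positivity,
      fun h hp hlt f osc hf hosc => ?_⟩
    refine H.lintegral_thickening_le hp ?_ hf hosc
    rwa [lt_div_iff₀ (by positivity), mul_comm] at hlt

/-- A short segment joining a point of `Ω` to a point outside of `Ω` stays close to `∂Ω`. -/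
theorem mem_thickening_frontier {x y : Euc n} {h : ℝ} (hxy : dist x y < h)
    (hmem : ¬ (x ∈ Ω ↔ y ∈ Ω)) : x ∈ Metric.thickening h (frontier Ω) := by
  have hne : (segment ℝ x y ∩ frontier Ω).Nonempty := by
    have hc : IsPreconnected (segment ℝ x y) := (convex_segment x y).isPreconnected
    by_contra hdis
    rw [Set.not_nonempty_iff_eq_empty, ← Set.disjoint_iff_inter_eq_empty] at hdis
    have hsub : segment ℝ x y ⊆ interior Ω ∪ (closure Ω)ᶜ := fun z hz => by
      by_cases h1 : z ∈ closure Ω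
      · left
        by_contra h2
        exact Set.disjoint_left.1 hdis hz ⟨h1, h2⟩
      · exact Or.inr h1
    have hx := left_mem_segment ℝ x y
    have hy := right_mem_segment ℝ x y
    rcases hc.subset_or_subset isOpen_interior isClosed_closure.isOpen_compl
      (Set.disjoint_left.2 fun z h1 h2 => h2 (subset_closure (interior_subset h1))) hsub
      with h1 | h1
    · exact hmem ⟨fun _ => interior_subset (h1 hy), fun _ => interior_subset (h1 hx)⟩
    · exact hmem ⟨fun h2 => absurd (subset_closure h2) (h1 hx),
        fun h2 => absurd (subset_closure h2) (h1 hy)⟩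
  obtain ⟨z, hz, hzf⟩ := hne
  refine Metric.mem_thickening_iff.2 ⟨z, hzf, ?_⟩
  have h1 := dist_add_dist_of_mem_segment hz
  have h2 := dist_nonneg (x := z) (y := y)
  linarith

/-- The integral of a directional derivative over `Ω` is controlled by the boundary values.

The difference quotient `h⁻¹ ∫_Ω (ψ(x + hv) - ψ(x)) dx` only involves the points where the indicator
functions of `Ω` and `Ω + hv` differ, and these lie within `h` of `∂Ω`. This replaces the divergence
theorem, and so avoids normal vectors, which exist only almost everywhere. -/
theorem exists_integral_fderiv_le (hΩ : IsLipschitzDomain Ω) (hb : Bornology.IsBounded Ω) :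
    ∃ C : ℝ, 0 ≤ C ∧ ∀ ψ : Euc n → ℝ, ContDiff ℝ 1 ψ → HasCompactSupport ψ →
      ∀ v : Euc n, ‖v‖ ≤ 1 →
        |∫ x in Ω, fderiv ℝ ψ x v| ≤ C * ∫ x, |ψ x| ∂(surfaceMeasure Ω) := by
  obtain ⟨L, D, h₀, hL, hD, hh₀, hH⟩ := exists_lintegral_thickening_le hΩ hb
  have hfin := isFiniteMeasure_surfaceMeasure hΩ.lipschitz hb
  have hΩm := hΩ.isOpen.measurableSet
  refine ⟨2 * D, by positivity, fun ψ hψ hc v hv => ?_⟩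
  obtain ⟨Λ, hΛ⟩ := hψ.lipschitzWith_of_hasCompactSupport hc one_ne_zero
  set S := (surfaceMeasure Ω).real Set.univ with hSdef
  set I := ∫ x, |ψ x| ∂(surfaceMeasure Ω) with hI
  have hψi : Integrable ψ := hψ.continuous.integrable_of_hasCompactSupport hc
  have hψσ : Integrable (fun x => |ψ x|) (surfaceMeasure Ω) :=
    (hψ.continuous.integrable_of_hasCompactSupport hc).abs
  have htube : ∀ h, 0 < h → h < h₀ →
      ∫ x in Metric.thickening h (frontier Ω), |ψ x| ≤ D * h * (I + Λ * (L * h) * S) := by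
    intro h hp hlt
    have h1 := hH h hp hlt (fun x => ENNReal.ofReal |ψ x|) (ENNReal.ofReal (Λ * (L * h)))
      hψ.continuous.abs.measurable.ennreal_ofReal (fun y z hyz => by
        rw [← ENNReal.ofReal_add (abs_nonneg _) (by positivity)]
        refine ENNReal.ofReal_le_ofReal ?_
        have h2 := hΛ.dist_le_mul y z
        rw [Real.dist_eq] at h2
        have h3 := abs_sub_abs_le_abs_sub (ψ y) (ψ z)
        have h4 := mul_le_mul_of_nonneg_left hyz Λ.2
        have h5 : |ψ y - ψ z| ≤ Λ * (L * h) := h2.trans h4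
        linarith)
    rw [← ofReal_integral_eq_lintegral_ofReal hψσ (Eventually.of_forall fun x => abs_nonneg _),
      ← ofReal_integral_eq_lintegral_ofReal hψi.abs.integrableOn
        (Eventually.of_forall fun x => abs_nonneg _), ← ofReal_measureReal,
      ← ENNReal.ofReal_mul (by positivity), ← ENNReal.ofReal_add
        (integral_nonneg fun x => abs_nonneg _) (by positivity),
      ← ENNReal.ofReal_mul (by positivity)] at h1
    exact (ENNReal.ofReal_le_ofReal_iff (mul_nonneg (by positivity)
      (add_nonneg (integral_nonneg fun x => abs_nonneg _) (by positivity)))).1 h1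
  have hquot : ∀ h, 0 < h → 2 * h < h₀ →
      |∫ x, (h⁻¹ • (ψ (x + h • v) - ψ x)) * Ω.indicator 1 x| ≤
        2 * D * (I + Λ * (L * (2 * h)) * S) := by
    intro h hp hlt
    have hi1 : Integrable fun x => ψ (x + h • v) * Ω.indicator 1 x := by
      have : (fun x => ψ (x + h • v) * Ω.indicator 1 x) =
          Ω.indicator fun x => ψ (x + h • v) := by
        ext x; by_cases hx : x ∈ Ω <;> simp [hx]
      rw [this]
      exact (hψi.comp_add_right _).indicator hΩm
    have hi2 : Integrable fun x => ψ x * Ω.indicator 1 x := by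
      have : (fun x => ψ x * Ω.indicator 1 x) = Ω.indicator ψ := by
        ext x; by_cases hx : x ∈ Ω <;> simp [hx]
      rw [this]
      exact hψi.indicator hΩm
    have hi3 : Integrable fun x => ψ x * Ω.indicator 1 (x - h • v) := by
      have := hi1.comp_sub_right (h • v)
      simpa using this
    have e1 : ∫ x, ψ (x + h • v) * Ω.indicator 1 x = ∫ x, ψ x * Ω.indicator 1 (x - h • v) := by
      rw [← integral_sub_right_eq_self _ (h • v)]
      simp
    have e2 : ∫ x, (h⁻¹ • (ψ (x + h • v) - ψ x)) * Ω.indicator 1 x =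
        h⁻¹ * ∫ x, (ψ x * Ω.indicator 1 (x - h • v) - ψ x * Ω.indicator 1 x) := by
      rw [integral_sub hi3 hi2, ← e1, ← integral_sub hi1 hi2, ← integral_const_mul]
      refine integral_congr_ae (Eventually.of_forall fun x => ?_)
      simp only [smul_eq_mul]
      ring
    have hSm : MeasurableSet (Metric.thickening (2 * h) (frontier Ω)) :=
      Metric.isOpen_thickening.measurableSet
    have e3 : |∫ x, (ψ x * Ω.indicator 1 (x - h • v) - ψ x * Ω.indicator 1 x)| ≤
        ∫ x in Metric.thickening (2 * h) (frontier Ω), |ψ x| := by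
      rw [← integral_indicator hSm]
      rw [← Real.norm_eq_abs]
      refine norm_integral_le_of_norm_le (hψi.abs.indicator hSm) (Eventually.of_forall fun x => ?_)
      by_cases hx : (x ∈ Ω ↔ x - h • v ∈ Ω)
      · have : Ω.indicator (1 : Euc n → ℝ) (x - h • v) = Ω.indicator 1 x := by
          by_cases hx1 : x ∈ Ω
          · rw [Set.indicator_of_mem hx1, Set.indicator_of_mem (hx.1 hx1)]; rfl
          · rw [Set.indicator_of_notMem hx1, Set.indicator_of_notMem fun h2 => hx1 (hx.2 h2)]
        rw [this, sub_self, norm_zero]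
        exact Set.indicator_nonneg (fun _ _ => abs_nonneg _) x
      · have hd : dist x (x - h • v) < 2 * h := by
          rw [dist_eq_norm, sub_sub_cancel, norm_smul, Real.norm_eq_abs, abs_of_pos hp]
          nlinarith
        rw [Set.indicator_of_mem (mem_thickening_frontier hd hx), ← mul_sub, norm_mul,
          Real.norm_eq_abs]
        refine mul_le_of_le_one_right (abs_nonneg _) ?_
        by_cases h1 : x ∈ Ω <;> by_cases h2 : x - h • v ∈ Ω <;> simp [h1, h2]
    rw [e2, abs_mul, abs_of_pos (inv_pos.2 hp)]
    refine (mul_le_mul_of_nonneg_left (e3.trans (htube (2 * h) (by positivity) hlt))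
      (inv_pos.2 hp).le).trans_eq ?_
    field_simp
  have hind : Integrable (Ω.indicator (1 : Euc n → ℝ)) :=
    (integrable_indicator_iff hΩm).2 (integrableOn_const hb.measure_lt_top.ne)
  have hlim := hΛ.integral_inv_smul_sub_mul_tendsto_integral_lineDeriv_mul hind v
  have hlim2 : ∫ x, lineDeriv ℝ ψ x v * Ω.indicator 1 x = ∫ x in Ω, fderiv ℝ ψ x v := by
    rw [← integral_indicator hΩm]
    refine integral_congr_ae (Eventually.of_forall fun x => ?_)
    simp only
    rw [(hψ.differentiable one_ne_zero x).lineDeriv_eq_fderiv]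
    by_cases hx : x ∈ Ω <;> simp [hx]
  rw [hlim2] at hlim
  have hrhs : Tendsto (fun h : ℝ => 2 * D * (I + Λ * (L * (2 * h)) * S)) (𝓝[>] 0)
      (𝓝 (2 * D * (I + Λ * (L * (2 * 0)) * S))) :=
    (Continuous.tendsto (by fun_prop) _).mono_left nhdsWithin_le_nhds
  have hfinal := le_of_tendsto_of_tendsto hlim.abs hrhs (by
    have h1 : ∀ᶠ h : ℝ in 𝓝[>] 0, h < h₀ / 2 :=
      nhdsWithin_le_nhds (eventually_lt_nhds (by positivity))
    filter_upwards [h1, self_mem_nhdsWithin] with h hlt hp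
    exact hquot h hp (by linarith))
  simpa using hfinal

/-- Friedrichs' inequality: the `L²(Ω)` norm is controlled by the gradient and the trace.

The identity `φ² = ∂ᵢ(xᵢ φ²) - 2 xᵢ φ ∂ᵢφ` is integrated over `Ω`; the first term is a boundary
contribution and half of `∫ φ²` absorbs the second one. -/
theorem exists_friedrichs_inequality (hn : 0 < n) (hΩ : IsLipschitzDomain Ω)
    (hb : Bornology.IsBounded Ω) :
    ∃ C : ℝ, 0 ≤ C ∧ ∀ φ : Euc n → ℝ, ContDiff ℝ 1 φ →
      ∫ x in Ω, φ x ^ 2 ≤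
        C * ((∫ x in Ω, ‖gradient φ x‖ ^ 2) + ∫ x, φ x ^ 2 ∂(surfaceMeasure Ω)) := by
  obtain ⟨C, hC, hdiv⟩ := exists_integral_fderiv_le hΩ hb
  have hfin := isFiniteMeasure_surfaceMeasure hΩ.lipschitz hb
  have hΩm := hΩ.isOpen.measurableSet
  obtain ⟨R, hR, hsub⟩ := hb.closure.subset_ball_lt 0 (0 : Euc n)
  let i : Fin n := ⟨0, hn⟩
  set e : Euc n := EuclideanSpace.single i 1 with he
  have hxi : ∀ x ∈ closure Ω, |x i| ≤ R := fun x hx =>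
    (PiLp.norm_apply_le x i).trans (mem_ball_zero_iff.1 (hsub hx)).le
  -- A cut-off equal to one on `closure Ω`, to make `xᵢ φ²` compactly supported.
  let η : ContDiffBump (0 : Euc n) := ⟨R, R + 1, hR, by linarith⟩
  have hη1 : ∀ x ∈ closure Ω, η x = 1 := fun x hx =>
    η.one_of_mem_closedBall (Metric.ball_subset_closedBall (hsub hx))
  refine ⟨2 * C * R + 4 * R ^ 2, by positivity, fun φ hφ => ?_⟩
  set ψ : Euc n → ℝ := fun x => η x * (x i * φ x ^ 2) with hψdef
  have hxc : ContDiff ℝ 1 fun x : Euc n => x i := by fun_prop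
  have hψ : ContDiff ℝ 1 ψ := η.contDiff.mul (hxc.mul (hφ.pow 2))
  have hcψ : HasCompactSupport ψ := η.hasCompactSupport.mul_right
  have hd : ∀ x ∈ Ω, fderiv ℝ ψ x e = φ x ^ 2 + 2 * x i * φ x * fderiv ℝ φ x e := by
    intro x hx
    have h1 : ψ =ᶠ[𝓝 x] fun x => x i * φ x ^ 2 :=
      (hΩ.isOpen.eventually_mem hx).mono fun y hy => by
        rw [hψdef]
        simp only
        rw [hη1 y (subset_closure hy), one_mul]
    have h2 : HasFDerivAt (fun x : Euc n => x i) (EuclideanSpace.proj (𝕜 := ℝ) i) x :=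
      (EuclideanSpace.proj (𝕜 := ℝ) i).hasFDerivAt
    have h3 := h2.mul ((hφ.differentiable one_ne_zero x).hasFDerivAt.pow 2)
    have h4 : fderiv ℝ ψ x = _ := h1.fderiv_eq.trans h3.fderiv
    rw [h4]
    simp [he]
    ring
  obtain ⟨hi1, hi2⟩ := integrable_sq_restrict hb hφ
  have hφσ : Integrable (fun x => φ x ^ 2) (surfaceMeasure Ω) := by
    have h1 : Integrable (fun x => η x * φ x ^ 2) (surfaceMeasure Ω) :=
      (η.continuous.mul (hφ.continuous.pow 2)).integrable_of_hasCompactSupport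
        η.hasCompactSupport.mul_right
    refine h1.congr ?_
    filter_upwards [ae_restrict_mem isClosed_frontier.measurableSet] with x hx
    rw [hη1 x (frontier_subset_closure hx), one_mul]
  have hbd : ∫ x, |ψ x| ∂(surfaceMeasure Ω) ≤ R * ∫ x, φ x ^ 2 ∂(surfaceMeasure Ω) := by
    rw [← integral_const_mul]
    refine integral_mono_ae (hψ.continuous.integrable_of_hasCompactSupport hcψ).abs
      (hφσ.const_mul R) ?_
    filter_upwards [ae_restrict_mem isClosed_frontier.measurableSet] with x hx
    have hx' := frontier_subset_closure hx
    simp only [hψdef]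
    rw [hη1 x hx', one_mul, abs_mul, abs_of_nonneg (sq_nonneg (φ x))]
    exact mul_le_mul_of_nonneg_right (hxi x hx') (sq_nonneg _)
  have hdi : Integrable (fun x => fderiv ℝ ψ x e) (volume.restrict Ω) := by
    have hdc := (hψ.continuous_fderiv one_ne_zero).clm_apply (continuous_const (y := e))
    exact (hdc.integrable_of_hasCompactSupport (hcψ.fderiv_apply (𝕜 := ℝ) _)).integrableOn
  have hmain : ∫ x in Ω, φ x ^ 2 ≤
      ∫ x in Ω, (fderiv ℝ ψ x e + (1 / 2 * φ x ^ 2 + 2 * R ^ 2 * ‖gradient φ x‖ ^ 2)) := by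
    refine integral_mono_ae hi1 (hdi.add ((hi1.const_mul _).add (hi2.const_mul _))) ?_
    filter_upwards [ae_restrict_mem hΩm] with x hx
    change _ ≤ fderiv ℝ ψ x e + (1 / 2 * φ x ^ 2 + 2 * R ^ 2 * ‖gradient φ x‖ ^ 2)
    rw [hd x hx]
    have h1 : |fderiv ℝ φ x e| ≤ ‖gradient φ x‖ := by
      have := (fderiv ℝ φ x).le_opNorm e
      rwa [he, PiLp.norm_single, norm_one, mul_one, ← norm_gradient] at this
    have h2 : |x i * fderiv ℝ φ x e| ≤ R * ‖gradient φ x‖ := by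
      rw [abs_mul]
      exact mul_le_mul (hxi x (subset_closure hx)) h1 (abs_nonneg _) hR.le
    have h3 : (x i * fderiv ℝ φ x e) ^ 2 ≤ (R * ‖gradient φ x‖) ^ 2 := by
      rw [← sq_abs]
      exact pow_le_pow_left₀ (abs_nonneg _) h2 2
    nlinarith [sq_nonneg (φ x / 2 + x i * fderiv ℝ φ x e)]
  have hsplit : ∫ x in Ω, (fderiv ℝ ψ x e + (1 / 2 * φ x ^ 2 + 2 * R ^ 2 * ‖gradient φ x‖ ^ 2)) =
      (∫ x in Ω, fderiv ℝ ψ x e) + (1 / 2 * (∫ x in Ω, φ x ^ 2) +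
        2 * R ^ 2 * ∫ x in Ω, ‖gradient φ x‖ ^ 2) := by
    rw [← integral_const_mul, ← integral_const_mul,
      ← integral_add (hi1.const_mul _) (hi2.const_mul _)]
    exact integral_add hdi ((hi1.const_mul _).add (hi2.const_mul _))
  rw [hsplit] at hmain
  have h5 := (le_abs_self _).trans (hdiv ψ hψ hcψ e (by rw [he, PiLp.norm_single]; simp))
  have h6 := mul_le_mul_of_nonneg_left hbd hC
  have h7 : 0 ≤ ∫ x in Ω, ‖gradient φ x‖ ^ 2 := integral_nonneg fun x => sq_nonneg _
  have h8 : 0 ≤ ∫ x, φ x ^ 2 ∂(surfaceMeasure Ω) := integral_nonneg fun x => sq_nonneg _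
  have h9 : 0 ≤ C * R := by positivity
  have h10 : 0 ≤ R ^ 2 := by positivity
  nlinarith [mul_nonneg h9 h7, mul_nonneg h10 h8]

end Friedrichs

/-! ### The trace operator and the space `H¹_∂(Ω)` -/

section TraceOperator

variable {n : ℕ} {Ω : Set (Euc n)}

theorem memLp_surfaceMeasure (hΩ : IsLipschitzDomain Ω) (hb : Bornology.IsBounded Ω)
    (φ : contDiffOne n) : MemLp φ.1 2 (surfaceMeasure Ω) := by
  have hfin := isFiniteMeasure_surfaceMeasure hΩ.lipschitz hb
  have hK : IsCompact (frontier Ω) := hb.isCompact_closure.of_isClosed_subset isClosed_frontier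
    frontier_subset_closure
  have hφ := (contDiffOne.contDiff φ).continuous
  obtain ⟨C, hC⟩ := hK.exists_bound_of_continuousOn hφ.continuousOn
  refine MemLp.of_bound hφ.aestronglyMeasurable C ?_
  filter_upwards [ae_restrict_mem isClosed_frontier.measurableSet] with x hx using hC x hx

/-- The restriction to `∂Ω` of a function of class `C¹`. -/
def restrictBoundary (hΩ : IsLipschitzDomain Ω) (hb : Bornology.IsBounded Ω) :
    contDiffOne n →ₗ[ℝ] L2Boundary Ω where
  toFun φ := (memLp_surfaceMeasure hΩ hb φ).toLp φ.1
  map_add' _ _ := rfl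
  map_smul' _ _ := rfl

theorem restrictBoundary_ae (hΩ : IsLipschitzDomain Ω) (hb : Bornology.IsBounded Ω)
    (φ : contDiffOne n) : restrictBoundary hΩ hb φ =ᵐ[surfaceMeasure Ω] φ.1 :=
  (memLp_surfaceMeasure hΩ hb φ).coeFn_toLp

theorem norm_sq_restrictBoundary (hΩ : IsLipschitzDomain Ω) (hb : Bornology.IsBounded Ω)
    (φ : contDiffOne n) :
    ‖restrictBoundary hΩ hb φ‖ ^ 2 = ∫ x, φ.1 x ^ 2 ∂(surfaceMeasure Ω) := by
  rw [← real_inner_self_eq_norm_sq, L2.inner_def]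
  refine integral_congr_ae ?_
  filter_upwards [restrictBoundary_ae hΩ hb φ] with x hx
  rw [hx, real_inner_self_eq_norm_sq, Real.norm_eq_abs, sq_abs]

theorem IsTraceOperator.apply_ofC1 (hΩ : IsLipschitzDomain Ω) (hb : Bornology.IsBounded Ω)
    {Γ : H1 Ω →L[ℝ] L2Boundary Ω} (hΓ : IsTraceOperator Ω Γ) (φ : contDiffOne n) :
    Γ (H1.ofC1 hb φ) = restrictBoundary hΩ hb φ :=
  Lp.ext ((hΓ _ _ (contDiffOne.contDiff φ) (H1.ofC1_val hb φ)).trans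
    (restrictBoundary_ae hΩ hb φ).symm)

theorem existsUnique_isTraceOperator (hΩ : IsLipschitzDomain Ω) (hb : Bornology.IsBounded Ω) :
    ∃! Γ : H1 Ω →L[ℝ] L2Boundary Ω, IsTraceOperator Ω Γ := by
  have hd := denseRange_ofC1 hΩ hb
  obtain ⟨C, hC, htr⟩ := exists_trace_inequality hΩ hb
  have hbound : ∃ C, ∀ φ, ‖restrictBoundary hΩ hb φ‖ ≤ C * ‖H1.ofC1 hb φ‖ := by
    refine ⟨√C, fun φ => ?_⟩
    have h := htr φ.1 (contDiffOne.contDiff φ)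
    rw [← norm_sq_restrictBoundary hΩ hb, ← H1.norm_sq_ofC1 hb] at h
    refine le_of_sq_le_sq ?_ (by positivity)
    rwa [mul_pow, Real.sq_sqrt hC]
  -- The extension by continuity of the restriction of `C¹` functions to the boundary.
  refine ⟨(restrictBoundary hΩ hb).extendOfNorm (H1.ofC1 hb), ?_, fun Γ hΓ => ?_⟩
  · intro u φ hφ hu
    rw [H1.eq_ofC1 hΩ.isOpen hb hφ hu, LinearMap.extendOfNorm_eq hd hbound]
    exact restrictBoundary_ae hΩ hb ⟨φ, hφ⟩
  · refine ContinuousLinearMap.ext fun u => ?_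
    refine congrFun (hd.equalizer Γ.continuous (ContinuousLinearMap.continuous _) ?_) u
    ext1 φ
    simp only [Function.comp_apply]
    rw [hΓ.apply_ofC1 hΩ hb, LinearMap.extendOfNorm_eq hd hbound]

namespace H1Boundary

variable {Γ : H1 Ω →L[ℝ] L2Boundary Ω}

theorem norm_sq_eq (u : H1Boundary Γ) :
    ‖u‖ ^ 2 = ‖H1.grad Ω (toH1 Γ u)‖ ^ 2 + ‖Γ (toH1 Γ u)‖ ^ 2 :=
  WithLp.prod_norm_sq_eq_of_L2 (gradTrace Γ u)

theorem _root_.H1.norm_sq_eq (u : H1 Ω) : ‖u‖ ^ 2 = ‖u.val‖ ^ 2 + ‖H1.grad Ω u‖ ^ 2 :=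
  WithLp.prod_norm_sq_eq_of_L2 u.1

/-- By Friedrichs' inequality the norm of `H¹_∂(Ω)` dominates the norm of `H¹(Ω)`. -/
theorem exists_norm_toH1_le (hn : 0 < n) (hΩ : IsLipschitzDomain Ω) (hb : Bornology.IsBounded Ω)
    (hΓ : IsTraceOperator Ω Γ) : ∃ C : ℝ, ∀ u : H1Boundary Γ, ‖toH1 Γ u‖ ≤ C * ‖u‖ := by
  obtain ⟨C, hC, hF⟩ := exists_friedrichs_inequality hn hΩ hb
  have hgc : Continuous fun u : H1 Ω => H1.grad Ω u :=
    (WithLp.continuous_snd 2 (Lp ℝ 2 (volume.restrict Ω))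
      (Lp (Euc n) 2 (volume.restrict Ω))).comp continuous_subtype_val
  have key : ∀ u : H1 Ω, ‖u‖ ^ 2 ≤ (C + 1) * (‖H1.grad Ω u‖ ^ 2 + ‖Γ u‖ ^ 2) := by
    intro u
    refine (denseRange_ofC1 hΩ hb).induction_on
      (p := fun u : H1 Ω => ‖u‖ ^ 2 ≤ (C + 1) * (‖H1.grad Ω u‖ ^ 2 + ‖Γ u‖ ^ 2)) u
      (isClosed_le (by fun_prop) (by fun_prop)) fun φ => ?_
    have h1 := hF φ.1 (contDiffOne.contDiff φ)
    have h2 : ‖H1.grad Ω (H1.ofC1 hb φ)‖ ^ 2 = ∫ x in Ω, ‖gradient φ.1 x‖ ^ 2 := by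
      rw [← real_inner_self_eq_norm_sq, L2.inner_def]
      refine integral_congr_ae ?_
      filter_upwards [H1.ofC1_grad hb φ] with x hx
      rw [hx, real_inner_self_eq_norm_sq]
    rw [H1.norm_sq_ofC1, hΓ.apply_ofC1 hΩ hb, h2, norm_sq_restrictBoundary hΩ hb]
    have h3 : 0 ≤ ∫ x, φ.1 x ^ 2 ∂(surfaceMeasure Ω) := integral_nonneg fun x => sq_nonneg _
    linarith
  refine ⟨√(C + 1), fun u => le_of_sq_le_sq ?_ (by positivity)⟩
  rw [mul_pow, Real.sq_sqrt (by positivity), norm_sq_eq]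
  exact key (toH1 Γ u)

theorem norm_le_toH1 (u : H1Boundary Γ) : ‖u‖ ≤ (1 + ‖Γ‖) * ‖toH1 Γ u‖ := by
  refine le_of_sq_le_sq ?_ (by positivity)
  rw [norm_sq_eq, mul_pow]
  have h1 := H1.norm_sq_eq (toH1 Γ u)
  have h2 := pow_le_pow_left₀ (norm_nonneg _) (Γ.le_opNorm (toH1 Γ u)) 2
  rw [mul_pow] at h2
  have h3 := norm_nonneg Γ
  have h4 := sq_nonneg ‖(toH1 Γ u).val‖
  have h5 : 0 ≤ 2 * ‖Γ‖ * ‖toH1 Γ u‖ ^ 2 := by positivity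
  nlinarith

theorem eq_zero_of_norm_eq_zero (hn : 0 < n) (hΩ : IsLipschitzDomain Ω)
    (hb : Bornology.IsBounded Ω) (hΓ : IsTraceOperator Ω Γ) (u : H1Boundary Γ) (hu : ‖u‖ = 0) :
    u = 0 := by
  obtain ⟨C, hC⟩ := exists_norm_toH1_le hn hΩ hb hΓ
  have h := hC u
  rw [hu, mul_zero] at h
  have h0 : toH1 Γ u = 0 := norm_le_zero_iff.1 h
  exact h0

theorem _root_.completeSpace_of_leftInverse {E G : Type*} [SeminormedAddCommGroup E]
    [NormedSpace ℝ E] [NormedAddCommGroup G] [NormedSpace ℝ G] [CompleteSpace G] (A : E →L[ℝ] G)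
    (B : G →L[ℝ] E) (h : ∀ u, B (A u) = u) : CompleteSpace E := by
  refine Metric.complete_of_cauchySeq_tendsto fun u hu => ?_
  obtain ⟨w, hw⟩ := cauchySeq_tendsto_of_complete (A.uniformContinuous.comp_cauchySeq hu)
  refine ⟨B w, ((B.continuous.tendsto w).comp hw).congr fun k => ?_⟩
  exact h (u k)

/-- The norms of `H¹_∂(Ω)` and `H¹(Ω)` are equivalent, so completeness carries over. -/
theorem completeSpace (hn : 0 < n) (hΩ : IsLipschitzDomain Ω)
    (hb : Bornology.IsBounded Ω) (hΓ : IsTraceOperator Ω Γ) : CompleteSpace (H1Boundary Γ) := by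
  obtain ⟨C, hC⟩ := exists_norm_toH1_le hn hΩ hb hΓ
  let A : H1Boundary Γ →L[ℝ] H1 Ω := (toH1 Γ).mkContinuous C hC
  let e : H1 Ω →ₗ[ℝ] H1Boundary Γ := LinearMap.id (R := ℝ) (M := H1 Ω)
  let B : H1 Ω →L[ℝ] H1Boundary Γ := e.mkContinuous (1 + ‖Γ‖) fun u => norm_le_toH1 (e u)
  exact completeSpace_of_leftInverse A B fun _ => rfl

/-- The traces of smooth functions are already dense in `L²(∂Ω)`, which makes `N(Γ*)` trivial. -/
theorem denseRange_trace (hΩ : IsLipschitzDomain Ω) (hb : Bornology.IsBounded Ω)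
    (hΓ : IsTraceOperator Ω Γ) : DenseRange (trace Γ) := by
  have hfin := isFiniteMeasure_surfaceMeasure hΩ.lipschitz hb
  refine (Lp.dense_hasCompactSupport_contDiff (F := ℝ) (μ := surfaceMeasure Ω) (p := 2)
    (by simp)).mono ?_
  rintro f ⟨ψ, hψ, -, hψc⟩
  have h1 : ContDiff ℝ 1 ψ := hψc.of_le (by simp)
  refine ⟨H1.ofC1 hb ⟨ψ, h1⟩, ?_⟩
  refine (hΓ.apply_ofC1 hΩ hb ⟨ψ, h1⟩).trans (Lp.ext ?_)
  exact (restrictBoundary_ae hΩ hb ⟨ψ, h1⟩).trans hψ.symm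

end H1Boundary

/-- The operator theoretic content, for a bounded operator with dense range between spaces that
are Hilbert spaces, the first one with a norm presented as a seminorm. -/
theorem moorePenrose_of_denseRange {E F : Type*} [i : SeminormedAddCommGroup E]
    [InnerProductSpace ℝ E] [CompleteSpace E] [NormedAddCommGroup F] [InnerProductSpace ℝ F]
    [CompleteSpace F] (hsep : ∀ x : E, ‖x‖ = 0 → x = 0) {A : E →L[ℝ] F} (hA : DenseRange A) :
    (∃! As : F →L[ℝ] E, IsAdjointOf A As) ∧ (∃! B : F →ₗ.[ℝ] E, IsMoorePenroseInverse A B) ∧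
      ∀ (As : F →L[ℝ] E) (B : F →ₗ.[ℝ] E), IsAdjointOf A As → IsMoorePenroseInverse A B →
        ∃ R : F →L[ℝ] F, IsInvOneAddAdjComp B R ∧ Set.range (A ∘L As) = Set.range R := by
  -- As `‖x‖ = 0` only for `x = 0`, the seminorm of `E` comes from a norm.
  obtain ⟨j, rfl⟩ : ∃ j : NormedAddCommGroup E, i = j.toSeminormedAddCommGroup :=
    ⟨NormedAddCommGroup.ofSeparation hsep, rfl⟩
  exact ⟨existsUnique_isAdjointOf A, existsUnique_isMoorePenroseInverse hA,
    fun As B hAs hB => exists_isInvOneAddAdjComp hA hAs hB⟩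

end TraceOperator

end

/-- On a bounded Lipschitz domain `Ω ⊂ ℝⁿ`, `n ≥ 2`, the trace operator `Γ` exists and is unique;
as an operator from `H¹_∂(Ω)` to `L²(∂Ω)` it has exactly one adjoint `Γ*` and exactly one
Moore–Penrose inverse `Λ`, the operator `(I + Λ*Λ)⁻¹` is bounded and everywhere defined, and
`R(ΓΓ*) = R((I + Λ*Λ)⁻¹)`, the right-hand side being the space `𝓗¹(∂Ω)`. -/
theorem proposition6p3 (n : ℕ) (hn : 2 ≤ n) (Ω : Set (Euc n)) (hΩ : IsLipschitzDomain Ω)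
    (hb : Bornology.IsBounded Ω) :
    (∃! Γ : H1 Ω →L[ℝ] L2Boundary Ω, IsTraceOperator Ω Γ) ∧
    ∀ Γ : H1 Ω →L[ℝ] L2Boundary Ω, IsTraceOperator Ω Γ →
      (∃! Γs : L2Boundary Ω →L[ℝ] H1Boundary Γ, IsAdjointOf (H1Boundary.trace Γ) Γs) ∧
      (∃! Λ : L2Boundary Ω →ₗ.[ℝ] H1Boundary Γ, IsMoorePenroseInverse (H1Boundary.trace Γ) Λ) ∧
      ∀ (Γs : L2Boundary Ω →L[ℝ] H1Boundary Γ) (Λ : L2Boundary Ω →ₗ.[ℝ] H1Boundary Γ),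
        IsAdjointOf (H1Boundary.trace Γ) Γs →
        IsMoorePenroseInverse (H1Boundary.trace Γ) Λ →
        ∃ R : L2Boundary Ω →L[ℝ] L2Boundary Ω, IsInvOneAddAdjComp Λ R ∧
          Set.range (H1Boundary.trace Γ ∘L Γs) = Set.range R := by
  refine ⟨existsUnique_isTraceOperator hΩ hb, fun Γ hΓ => ?_⟩
  have hn0 : 0 < n := by omega
  have hcomplete := H1Boundary.completeSpace hn0 hΩ hb hΓ
  exact moorePenrose_of_denseRange (H1Boundary.eq_zero_of_norm_eq_zero hn0 hΩ hb hΓ)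
    (H1Boundary.denseRange_trace hΩ hb hΓ)
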